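/- **Theorem 2.5.** All graphs are finite and simple. A *circle graph* is the intersection graph of a set of chords of a circle. For $k\ge 3$, a *$k$-polygon graph* is the intersection graph of a set of chords of a convex polygon with $k$ sides such that each chord has its endpoints on two distinct sides of the polygon. In all such representations the endpoints of the chords are pairwise distinct and are not corners of the polygon. A *$2$-polygon graph* is a permutation graph, that is, a graph with vertices $v_1,\dots,v_n$ for which there is a permutation $\pi$ of $\{1,\dots,n\}$ such that $v_iv_j$ is an edge if and only if $(i-j)(\pi^{-1}(i)-\pi^{-1}(j))<0$. The *polygon number* $\psi(G)$ of a graph $G$ is the minimum $k\ge 2$ such that $G$ is a $k$-polygon graph ($\psi(G)=\infty$ if there is no such $k$). 1. Every circle graph $G$ on $n\ge 3$ vertices satisfies $\psi(G)\le\lceil n/2\rceil$ (in particular, $\psi(G)$ is finite). 2. For every $n\ge 3$, the chordless cycle $C_n$ on $n$ vertices is a circle graph and $\psi(C_n)=\lceil n/2\rceil$. -/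

import Mathlib

/-! The Euclidean plane is represented by `ℂ`, regarded as a real vector space. -/

/-- A family of chords (the chord of the vertex `v` is the closed segment from `a v` to `b v`)
whose endpoints are pairwise distinct, and of which `G` is the intersection graph. -/
structure IsChordModel {V : Type*} (G : SimpleGraph V) (a b : V → ℂ) : Prop where
  /-- The `2 |V|` endpoints are pairwise distinct points. -/
  endpoints_distinct : Function.Injective (Sum.elim a b)
  /-- Two different vertices are adjacent if and only if their chords have a common point. -/
  adj_iff : ∀ u v : V, u ≠ v →
    (G.Adj u v ↔ (segment ℝ (a u) (b u) ∩ segment ℝ (a v) (b v)).Nonempty)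

/-- Circle graphs: intersection graphs of chords of a circle. -/
def IsCircleGraph {V : Type*} (G : SimpleGraph V) : Prop :=
  ∃ a b : V → ℂ,
    (∀ v, a v ∈ Metric.sphere (0 : ℂ) 1 ∧ b v ∈ Metric.sphere (0 : ℂ) 1) ∧ IsChordModel G a b

/-- The cross product of `q - p` and `r - p`; it is positive if and only if `r` lies strictly to
the left of the oriented line from `p` to `q`. -/
def planeOrient (p q r : ℂ) : ℝ :=
  (q.re - p.re) * (r.im - p.im) - (q.im - p.im) * (r.re - p.re)

/-- The corners `τ 0, …, τ (k - 1)`, listed counterclockwise, of a convex polygon with `k` sides: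
`k` is at least `3` and, for each side, all the corners that do not lie on it are strictly to the
left of it. The successor `finRotate k i` of `i` is `i + 1` modulo `k`. -/
structure IsConvexPolygon (k : ℕ) (τ : Fin k → ℂ) : Prop where
  three_le : 3 ≤ k
  left_of_side : ∀ i j : Fin k, j ≠ i → j ≠ finRotate k i →
    0 < planeOrient (τ i) (τ (finRotate k i)) (τ j)

/-- The `i`-th side of the polygon with corners `τ`, a closed segment. -/
def polygonSide {k : ℕ} (τ : Fin k → ℂ) (i : Fin k) : Set ℂ :=
  segment ℝ (τ i) (τ (finRotate k i))

/-- `G` is the intersection graph of chords of a convex polygon with `k ≥ 3` sides, where each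
chord has its endpoints on two distinct sides; no endpoint of a chord is a corner. -/
def HasPolygonRepresentation {V : Type*} (k : ℕ) (G : SimpleGraph V) : Prop :=
  ∃ τ : Fin k → ℂ, IsConvexPolygon k τ ∧
    ∃ a b : V → ℂ,
      (∀ v, ∃ i j : Fin k, i ≠ j ∧ a v ∈ polygonSide τ i ∧ b v ∈ polygonSide τ j) ∧
      (∀ v, a v ∉ Set.range τ ∧ b v ∉ Set.range τ) ∧
      IsChordModel G a b

/-- Permutation graphs: for some numbering `e` of the vertices by `0, …, n - 1` and some
permutation `π`, vertices number `i` and `j` are adjacent if and only if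
`(i - j) * (π⁻¹ i - π⁻¹ j) < 0`. -/
def IsPermutationGraph {V : Type*} [Fintype V] (G : SimpleGraph V) : Prop :=
  ∃ (e : V ≃ Fin (Fintype.card V)) (π : Equiv.Perm (Fin (Fintype.card V))), ∀ u v : V,
    G.Adj u v ↔
      (((e u : ℕ) : ℤ) - ((e v : ℕ) : ℤ)) *
        (((π.symm (e u) : ℕ) : ℤ) - ((π.symm (e v) : ℕ) : ℤ)) < 0

/-- `k`-polygon graphs for `k ≥ 2`; the `2`-polygon graphs are the permutation graphs. -/
def IsPolygonGraph {V : Type*} [Fintype V] (k : ℕ) (G : SimpleGraph V) : Prop :=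
  (k = 2 ∧ IsPermutationGraph G) ∨ (3 ≤ k ∧ HasPolygonRepresentation k G)

/-- The polygon number: the minimum `k` such that `G` is a `k`-polygon graph. It takes values in
`ℕ∞`, and is `⊤` if there is no such `k`. -/
noncomputable def polygonNumber {V : Type*} [Fintype V] (G : SimpleGraph V) : ℕ∞ :=
  ⨅ (k : ℕ) (_ : IsPolygonGraph k G), (k : ℕ∞)

/-!
A chord model, with the circle cut open at a point, is an interval model: `G` is the overlap graph
of intervals with distinct endpoints (`IsCircleGraph.exists_intervalModel`). If `k - 1` points
pierce all the intervals, then these points and the point of the cut become the corners of a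
polygon with `k` sides in which the two ends of each chord lie on different sides
(`IsIntervalModel.hasPolygonRepresentation`); for `k = 2` the orders of the left and of the right
ends give a permutation graph (`IsIntervalModel.isPermutationGraph`). So the upper bound says that
some interval model of `G` is pierced by at most `⌈n / 2⌉ - 1` points
(`IsIntervalModel.exists_pierced`).

If every vertex has at least two neighbours, then an inclusion-minimal interval takes up at least four
endpoints, its own and two of intervals that overlap it; piercing greedily thus needs at most a
quarter of the `2 n` endpoints, and a good choice of the cut saves the point that is missing.
Leaves are what makes a given model bad, since they may end up as many short intervals. They are
removed first, and drawn again as short intervals around an end of their neighbour. For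
this, one of the piercing points has to be next to one of the two ends of each neighbour `u` of a
leaf (`IsHat`), the first or the second, as is convenient. The greedy scan
(`IsIntervalModel.exists_greedy`) achieves this with a budget of four units per point, of which a
vertex with a leaf contributes four, and any other vertex two. Each vertex with a leaf has a leaf of
its own, so the total is at most `2 n`. The point of the cut serves as the hat of one of the
vertices. Components that are stars are drawn as outermost intervals.

For the cycle with `n ≥ 5` vertices, the chords that do not meet the chord of a given vertex `v` are
connected, so they lie on one side of it. The other side has a corner of the polygon in it, and such
sides are disjoint for vertices that are not adjacent. So each corner serves at most two vertices,
and `n ≤ 2 k` (`le_of_hasPolygonRepresentation_cycleGraph`).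
-/

/-! ### Orientation and chords of convex curves -/

open Complex in
/-- The orientation of three points of the unit circle, in terms of their angles. -/
lemma planeOrient_exp (α β γ : ℝ) :
    planeOrient (exp (α * I)) (exp (β * I)) (exp (γ * I)) =
      4 * Real.sin ((β - α) / 2) * Real.sin ((γ - β) / 2) * Real.sin ((γ - α) / 2) := by
  obtain ⟨a, rfl⟩ : ∃ a, α = 2 * a := ⟨α / 2, by ring⟩
  obtain ⟨b, rfl⟩ : ∃ b, β = 2 * b := ⟨β / 2, by ring⟩
  obtain ⟨c, rfl⟩ : ∃ c, γ = 2 * c := ⟨γ / 2, by ring⟩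
  have e1 : (2 * b - 2 * a) / 2 = b - a := by ring
  have e2 : (2 * c - 2 * b) / 2 = c - b := by ring
  have e3 : (2 * c - 2 * a) / 2 = c - a := by ring
  simp only [planeOrient, exp_ofReal_mul_I_re, exp_ofReal_mul_I_im, e1, e2, e3, Real.sin_sub,
    Real.sin_two_mul, Real.cos_two_mul']
  have ha := Real.sin_sq_add_cos_sq a
  have hb := Real.sin_sq_add_cos_sq b
  have hc := Real.sin_sq_add_cos_sq c
  generalize Real.sin a = A at *
  generalize Real.cos a = A' at *
  generalize Real.sin b = B at *
  generalize Real.cos b = B' at *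
  generalize Real.sin c = C at *
  generalize Real.cos c = C' at *
  grind

lemma planeOrient_exp_pos {α β γ : ℝ} (h1 : α < β) (h2 : β < γ) (h3 : γ < α + 2 * Real.pi) :
    0 < planeOrient (Complex.exp (α * Complex.I)) (Complex.exp (β * Complex.I))
      (Complex.exp (γ * Complex.I)) := by
  rw [planeOrient_exp]
  have s1 := Real.sin_pos_of_pos_of_lt_pi (x := (β - α) / 2) (by linarith) (by linarith)
  have s2 := Real.sin_pos_of_pos_of_lt_pi (x := (γ - β) / 2) (by linarith) (by linarith)
  have s3 := Real.sin_pos_of_pos_of_lt_pi (x := (γ - α) / 2) (by linarith) (by linarith)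
  positivity

lemma planeOrient_exp_nonneg {α β γ : ℝ} (h1 : α ≤ β) (h2 : β ≤ γ) (h3 : γ ≤ α + 2 * Real.pi) :
    0 ≤ planeOrient (Complex.exp (α * Complex.I)) (Complex.exp (β * Complex.I))
      (Complex.exp (γ * Complex.I)) := by
  rw [planeOrient_exp]
  have s1 := Real.sin_nonneg_of_nonneg_of_le_pi (x := (β - α) / 2) (by linarith) (by linarith)
  have s2 := Real.sin_nonneg_of_nonneg_of_le_pi (x := (γ - β) / 2) (by linarith) (by linarith)
  have s3 := Real.sin_nonneg_of_nonneg_of_le_pi (x := (γ - α) / 2) (by linarith) (by linarith)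
  positivity

lemma planeOrient_rotate (p q r : ℂ) : planeOrient p q r = planeOrient q r p := by
  simp only [planeOrient]; ring

lemma planeOrient_swap (p q r : ℂ) : planeOrient p q r = -planeOrient p r q := by
  simp only [planeOrient]; ring

lemma planeOrient_left (p q : ℂ) : planeOrient p q p = 0 := by
  simp only [planeOrient]; ring

lemma planeOrient_right (p q : ℂ) : planeOrient p q q = 0 := by
  simp only [planeOrient]; ring

/-- `planeOrient p q` is an affine function. -/
lemma planeOrient_combo (p q x y : ℂ) (s t : ℝ) (h : s + t = 1) :
    planeOrient p q (s • x + t • y) = s * planeOrient p q x + t * planeOrient p q y := by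
  obtain rfl : s = 1 - t := by linarith
  simp [planeOrient]; ring

/-- Two points on the same strict side of a line span a segment on that side. -/
lemma segment_disjoint_of_same_side {p q r s : ℂ}
    (h : 0 < planeOrient p q r * planeOrient p q s) :
    ¬ (segment ℝ p q ∩ segment ℝ r s).Nonempty := by
  rintro ⟨z, ⟨a, b, ha, hb, hab, rfl⟩, ⟨c, d, hc, hd, hcd, hz⟩⟩
  have h1 := planeOrient_combo p q p q a b hab
  have h2 := planeOrient_combo p q r s c d hcd
  rw [planeOrient_left, planeOrient_right] at h1
  rw [hz, h1] at h2
  rcases pos_and_pos_or_neg_and_neg_of_mul_pos h with ⟨h3, h4⟩ | ⟨h3, h4⟩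
  · rcases hc.eq_or_lt with rfl | hc
    · obtain rfl : d = 1 := by linarith
      linarith
    · nlinarith [mul_pos hc h3, mul_nonneg hd h4.le]
  · rcases hc.eq_or_lt with rfl | hc
    · obtain rfl : d = 1 := by linarith
      linarith
    · nlinarith [mul_pos_of_neg_of_neg (neg_lt_zero.2 hc) h3,
        mul_nonneg_of_nonpos_of_nonpos (neg_nonpos.2 hd) h4.le]

/-- Two segments each of which separates the endpoints of the other one have a common point. -/
lemma segment_inter_of_opposite_sides {p q r s : ℂ}
    (h1 : planeOrient p q r * planeOrient p q s < 0)
    (h2 : planeOrient r s p * planeOrient r s q < 0) :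
    (segment ℝ p q ∩ segment ℝ r s).Nonempty := by
  have key : ∀ x y : ℝ, x * y < 0 → 0 ≤ x / (x - y) ∧ 0 ≤ -y / (x - y) ∧ x - y ≠ 0 := by
    intro x y hxy
    rcases mul_neg_iff.1 hxy with ⟨hx, hy⟩ | ⟨hx, hy⟩
    · exact ⟨div_nonneg hx.le (by linarith), div_nonneg (by linarith) (by linarith),
        by linarith⟩
    · exact ⟨div_nonneg_of_nonpos hx.le (by linarith),
        div_nonneg_of_nonpos (by linarith) (by linarith), by linarith⟩
  obtain ⟨a1, a2, a3⟩ := key _ _ h1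
  obtain ⟨b1, b2, b3⟩ := key _ _ h2
  refine ⟨_, ⟨_, _, b2, b1, ?_, rfl⟩, ⟨_, _, a2, a1, ?_, ?_⟩⟩
  · field_simp; ring
  · field_simp; ring
  · have e : planeOrient r s p - planeOrient r s q =
        -(planeOrient p q r - planeOrient p q s) := by
      simp only [planeOrient]; ring
    rw [e] at b3 ⊢
    apply Complex.ext
    · simp only [Complex.add_re, Complex.real_smul, Complex.re_ofReal_mul]
      field_simp
      simp only [planeOrient]; ring
    · simp only [Complex.add_im, Complex.real_smul, Complex.im_ofReal_mul]
      field_simp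
      simp only [planeOrient]; ring

/-- Two chords of a convex curve `γ` meet if and only if their endpoints interleave. Convexity
enters as: with respect to the line of a chord, points of the curve between the endpoints of the
chord lie strictly on the right, the others strictly on the left. -/
lemma chords_meet_iff (γ : ℝ → ℂ) {a b c d : ℝ}
    (hab : a < b) (hcd : c < d) (hac : a ≠ c) (had : a ≠ d) (hbc : b ≠ c) (hbd : b ≠ d)
    (h1 : ∀ x, x = c ∨ x = d → (a < x → x < b → planeOrient (γ a) (γ b) (γ x) < 0) ∧
      (x < a ∨ b < x → 0 < planeOrient (γ a) (γ b) (γ x)))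
    (h2 : ∀ x, x = a ∨ x = b → (c < x → x < d → planeOrient (γ c) (γ d) (γ x) < 0) ∧
      (x < c ∨ d < x → 0 < planeOrient (γ c) (γ d) (γ x))) :
    (segment ℝ (γ a) (γ b) ∩ segment ℝ (γ c) (γ d)).Nonempty ↔
      (a < c ∧ c < b ∧ b < d) ∨ (c < a ∧ a < d ∧ d < b) := by
  constructor
  · intro h
    by_contra hn
    refine segment_disjoint_of_same_side ?_ h
    have hc := h1 c (.inl rfl)
    have hd := h1 d (.inr rfl)
    by_cases ho : (c < a ∨ b < c) ∧ (d < a ∨ b < d)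
    · exact mul_pos (hc.2 ho.1) (hd.2 ho.2)
    · by_cases hi : (a < c ∧ c < b) ∧ (a < d ∧ d < b)
      · exact mul_pos_of_neg_of_neg (hc.1 hi.1.1 hi.1.2) (hd.1 hi.2.1 hi.2.2)
      · rcases lt_or_gt_of_ne hac with e1 | e1 <;> rcases lt_or_gt_of_ne had with e2 | e2 <;>
          rcases lt_or_gt_of_ne hbc with e3 | e3 <;> rcases lt_or_gt_of_ne hbd with e4 | e4 <;>
          grind
  · rintro (⟨e1, e2, e3⟩ | ⟨e1, e2, e3⟩)
    · exact segment_inter_of_opposite_sides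
        (mul_neg_of_neg_of_pos ((h1 c (.inl rfl)).1 e1 e2) ((h1 d (.inr rfl)).2 (.inr e3)))
        (mul_neg_of_pos_of_neg ((h2 a (.inl rfl)).2 (.inl e1)) ((h2 b (.inr rfl)).1 e2 e3))
    · exact segment_inter_of_opposite_sides
        (mul_neg_of_pos_of_neg ((h1 c (.inl rfl)).2 (.inl e1)) ((h1 d (.inr rfl)).1 e2 e3))
        (mul_neg_of_neg_of_pos ((h2 a (.inl rfl)).1 e1 e2) ((h2 b (.inr rfl)).2 (.inr e3)))

/-- The convexity hypothesis of `chords_meet_iff` from the orientation of triples in increasing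
order. -/
lemma chord_sides (γ : ℝ → ℂ) {a b x : ℝ}
    (h1 : x < a → 0 < planeOrient (γ x) (γ a) (γ b))
    (h2 : a < x → x < b → 0 < planeOrient (γ a) (γ x) (γ b))
    (h3 : b < x → 0 < planeOrient (γ a) (γ b) (γ x)) :
    (a < x → x < b → planeOrient (γ a) (γ b) (γ x) < 0) ∧
      (x < a ∨ b < x → 0 < planeOrient (γ a) (γ b) (γ x)) := by
  refine ⟨fun e1 e2 => ?_, ?_⟩
  · rw [planeOrient_swap]; linarith [h2 e1 e2]
  · rintro (e | e)
    · rw [← planeOrient_rotate]; exact h1 e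
    · exact h3 e

/-! ### Interval models -/

/-- The intervals `[l u, r u]` and `[l v, r v]` overlap: they meet, and neither contains the
other one. -/
def Overlap {V : Type*} (l r : V → ℝ) (u v : V) : Prop :=
  (l u < l v ∧ l v < r u ∧ r u < r v) ∨ (l v < l u ∧ l u < r v ∧ r v < r u)

/-- The subgraph of `G` induced by `A` is the overlap graph of the intervals `[l v, r v]`, whose
endpoints are pairwise distinct. This is a chord model of that subgraph, the circle being cut open
at a point. -/
structure IsIntervalModel {V : Type*} (G : SimpleGraph V) (A : Finset V) (l r : V → ℝ) :
    Prop where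
  lt : ∀ v ∈ A, l v < r v
  left_ne : ∀ u ∈ A, ∀ v ∈ A, u ≠ v → l u ≠ l v
  right_ne : ∀ u ∈ A, ∀ v ∈ A, u ≠ v → r u ≠ r v
  left_ne_right : ∀ u ∈ A, ∀ v ∈ A, l u ≠ r v
  adj_iff : ∀ u ∈ A, ∀ v ∈ A, u ≠ v → (G.Adj u v ↔ Overlap l r u v)

lemma IsIntervalModel.mono {V : Type*} {G : SimpleGraph V} {A B : Finset V} {l r : V → ℝ}
    (h : IsIntervalModel G A l r) (hB : B ⊆ A) : IsIntervalModel G B l r where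
  lt v hv := h.lt v (hB hv)
  left_ne u hu v hv := h.left_ne u (hB hu) v (hB hv)
  right_ne u hu v hv := h.right_ne u (hB hu) v (hB hv)
  left_ne_right u hu v hv := h.left_ne_right u (hB hu) v (hB hv)
  adj_iff u hu v hv := h.adj_iff u (hB hu) v (hB hv)

/-- An interval model, drawn on a convex curve, is a chord model. -/
lemma IsIntervalModel.isChordModel {V : Type*} [Fintype V] {G : SimpleGraph V} {l r : V → ℝ}
    (h : IsIntervalModel G Finset.univ l r) (γ : ℝ → ℂ)
    (hinj : Set.InjOn γ (Set.range l ∪ Set.range r))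
    (hγ : ∀ u x, (∃ v, v ≠ u ∧ (x = l v ∨ x = r v)) →
      (l u < x → x < r u → planeOrient (γ (l u)) (γ (r u)) (γ x) < 0) ∧
      (x < l u ∨ r u < x → 0 < planeOrient (γ (l u)) (γ (r u)) (γ x))) :
    IsChordModel G (γ ∘ l) (γ ∘ r) where
  endpoints_distinct := by
    have key : Function.Injective (Sum.elim l r) := by
      rintro (u | u) (v | v) e <;> simp only [Sum.elim_inl, Sum.elim_inr] at e
      · by_contra hne
        exact h.left_ne u (by simp) v (by simp) (by simpa using hne) e
      · exact (h.left_ne_right u (by simp) v (by simp) e).elim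
      · exact (h.left_ne_right v (by simp) u (by simp) e.symm).elim
      · by_contra hne
        exact h.right_ne u (by simp) v (by simp) (by simpa using hne) e
    have e : Sum.elim (γ ∘ l) (γ ∘ r) = γ ∘ Sum.elim l r := by
      ext (x | x) <;> rfl
    rw [e]
    intro x y hxy
    refine key (hinj ?_ ?_ hxy)
    · cases x <;> simp
    · cases y <;> simp
  adj_iff u v huv := by
    rw [h.adj_iff u (by simp) v (by simp) huv]
    refine (chords_meet_iff γ (h.lt u (by simp)) (h.lt v (by simp))
      (h.left_ne u (by simp) v (by simp) huv) (h.left_ne_right u (by simp) v (by simp))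
      (h.left_ne_right v (by simp) u (by simp)).symm (h.right_ne u (by simp) v (by simp) huv)
      (fun x hx => hγ u x ⟨v, huv.symm, hx⟩) (fun x hx => hγ v x ⟨u, huv, hx⟩)).symm

lemma arg_injOn_sphere : Set.InjOn Complex.arg (Metric.sphere (0 : ℂ) 1) := by
  intro x hx y hy h
  refine Complex.ext_norm_arg ?_ h
  rw [mem_sphere_zero_iff_norm] at hx hy
  rw [hx, hy]

lemma exp_arg_of_mem_sphere {z : ℂ} (hz : z ∈ Metric.sphere (0 : ℂ) 1) :
    Complex.exp (Complex.arg z * Complex.I) = z := by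
  have := Complex.norm_mul_exp_arg_mul_I z
  rw [mem_sphere_zero_iff_norm] at hz
  simpa [hz] using this

/-- The circle is a convex curve. -/
lemma exp_chord_sides {a b x : ℝ} (hab : a < b) (h1 : b < x + 2 * Real.pi)
    (h2 : x < a + 2 * Real.pi) (h3 : b < a + 2 * Real.pi) :
    let γ : ℝ → ℂ := fun t => Complex.exp (t * Complex.I)
    (a < x → x < b → planeOrient (γ a) (γ b) (γ x) < 0) ∧
      (x < a ∨ b < x → 0 < planeOrient (γ a) (γ b) (γ x)) :=
  chord_sides (fun t => Complex.exp (t * Complex.I))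
    (fun h => planeOrient_exp_pos h hab h1)
    (fun h h' => planeOrient_exp_pos h h' h3)
    (fun h => planeOrient_exp_pos hab h h2)

/-- Cutting the circle open at `-1` turns a chord model into an interval model. -/
lemma IsCircleGraph.exists_intervalModel {V : Type*} [Fintype V] {G : SimpleGraph V}
    (hG : IsCircleGraph G) : ∃ l r : V → ℝ, IsIntervalModel G Finset.univ l r := by
  obtain ⟨a, b, hs, hm⟩ := hG
  have hinj := hm.endpoints_distinct
  have haa : ∀ u v, u ≠ v → (a u).arg ≠ (a v).arg := fun u v huv e =>
    huv (by simpa using @hinj (.inl u) (.inl v) (arg_injOn_sphere (hs u).1 (hs v).1 e))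
  have hbb : ∀ u v, u ≠ v → (b u).arg ≠ (b v).arg := fun u v huv e =>
    huv (by simpa using @hinj (.inr u) (.inr v) (arg_injOn_sphere (hs u).2 (hs v).2 e))
  have hab : ∀ u v, (a u).arg ≠ (b v).arg := fun u v e => by
    simpa using @hinj (.inl u) (.inr v) (arg_injOn_sphere (hs u).1 (hs v).2 e)
  let l : V → ℝ := fun v => min (a v).arg (b v).arg
  let r : V → ℝ := fun v => max (a v).arg (b v).arg
  have hl : ∀ v, l v = (a v).arg ∧ r v = (b v).arg ∧ (a v).arg < (b v).arg ∨
      l v = (b v).arg ∧ r v = (a v).arg ∧ (b v).arg < (a v).arg := by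
    intro v
    rcases lt_or_gt_of_ne (hab v v) with e | e
    · exact .inl ⟨min_eq_left e.le, max_eq_right e.le, e⟩
    · exact .inr ⟨min_eq_right e.le, max_eq_left e.le, e⟩
  clear_value l r
  have hlt : ∀ v, l v < r v := fun v => by
    rcases hl v with ⟨h1, h2, h3⟩ | ⟨h1, h2, h3⟩ <;> rw [h1, h2] <;> exact h3
  have hrange : ∀ v, (-Real.pi < l v ∧ l v ≤ Real.pi) ∧ (-Real.pi < r v ∧ r v ≤ Real.pi) := by
    intro v
    rcases hl v with ⟨h1, h2, h3⟩ | ⟨h1, h2, h3⟩ <;> rw [h1, h2] <;>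
      exact ⟨⟨Complex.neg_pi_lt_arg _, Complex.arg_le_pi _⟩,
        ⟨Complex.neg_pi_lt_arg _, Complex.arg_le_pi _⟩⟩
  have hll : ∀ u v, u ≠ v → l u ≠ l v := by
    intro u v huv
    rcases hl u with ⟨h1, -, -⟩ | ⟨h1, -, -⟩ <;> rcases hl v with ⟨h2, -, -⟩ | ⟨h2, -, -⟩ <;>
      rw [h1, h2]
    exacts [haa u v huv, hab u v, (hab v u).symm, hbb u v huv]
  have hrr : ∀ u v, u ≠ v → r u ≠ r v := by
    intro u v huv
    rcases hl u with ⟨-, h1, -⟩ | ⟨-, h1, -⟩ <;> rcases hl v with ⟨-, h2, -⟩ | ⟨-, h2, -⟩ <;>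
      rw [h1, h2]
    exacts [hbb u v huv, (hab v u).symm, hab u v, haa u v huv]
  have hlr : ∀ u v, l u ≠ r v := by
    intro u v
    by_cases huv : u = v
    · subst huv; exact (hlt u).ne
    rcases hl u with ⟨h1, -, -⟩ | ⟨h1, -, -⟩ <;> rcases hl v with ⟨-, h2, -⟩ | ⟨-, h2, -⟩ <;>
      rw [h1, h2]
    exacts [hab u v, haa u v huv, hbb u v huv, (hab v u).symm]
  refine ⟨l, r, fun v _ => hlt v, fun u _ v _ => hll u v, fun u _ v _ => hrr u v,
    fun u _ v _ => hlr u v, fun u _ v _ huv => ?_⟩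
  rw [hm.adj_iff u v huv]
  let γ : ℝ → ℂ := fun t => Complex.exp (t * Complex.I)
  have hseg : ∀ v, segment ℝ (a v) (b v) = segment ℝ (γ (l v)) (γ (r v)) := by
    intro v
    have e1 : γ (a v).arg = a v := exp_arg_of_mem_sphere (hs v).1
    have e2 : γ (b v).arg = b v := exp_arg_of_mem_sphere (hs v).2
    rcases hl v with ⟨h1, h2, -⟩ | ⟨h1, h2, -⟩ <;> rw [h1, h2, e1, e2]
    exact segment_symm _ _ _
  rw [hseg, hseg]
  refine chords_meet_iff γ (hlt u) (hlt v) (hll u v huv) (hlr u v) (hlr v u).symm (hrr u v huv)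
    ?_ ?_ <;>
  · rintro x (rfl | rfl) <;> refine exp_chord_sides (hlt _) ?_ ?_ ?_ <;>
      linarith [hrange u, hrange v, Real.pi_pos]

/-- Wrapping the real line around the circle turns an interval model into a chord model. -/
lemma IsIntervalModel.isCircleGraph {V : Type*} [Fintype V] {G : SimpleGraph V} {l r : V → ℝ}
    (h : IsIntervalModel G Finset.univ l r) (hl : ∀ v, 0 ≤ l v ∧ l v < 2 * Real.pi)
    (hr : ∀ v, 0 ≤ r v ∧ r v < 2 * Real.pi) : IsCircleGraph G := by
  let γ : ℝ → ℂ := fun t => Complex.exp (t * Complex.I)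
  have hmem : ∀ t, γ t ∈ Metric.sphere (0 : ℂ) 1 := fun t => by
    rw [mem_sphere_zero_iff_norm]; exact Complex.norm_exp_ofReal_mul_I t
  have hpos : ∀ x, x ∈ Set.range l ∪ Set.range r → 0 ≤ x ∧ x < 2 * Real.pi := by
    rintro x (⟨v, rfl⟩ | ⟨v, rfl⟩)
    exacts [hl v, hr v]
  refine ⟨γ ∘ l, γ ∘ r, fun v => ⟨hmem _, hmem _⟩, h.isChordModel γ ?_ ?_⟩
  · intro x hx y hy hxy
    have hx := hpos x hx
    have hy := hpos y hy
    obtain ⟨n, hn⟩ := Complex.exp_eq_exp_iff_exists_int.1 hxy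
    have e : x = y + n * (2 * Real.pi) := by
      have := congrArg Complex.im hn
      simpa using this
    have hpi := Real.pi_pos
    have h1 : (n : ℝ) < 1 := by nlinarith
    have h2 : (-1 : ℝ) < n := by nlinarith
    have : n = 0 := by
      have h1 : n < 1 := by exact_mod_cast h1
      have h2 : -1 < n := by exact_mod_cast h2
      omega
    simpa [this] using e
  · rintro u x ⟨v, -, hx⟩
    have : 0 ≤ x ∧ x < 2 * Real.pi := by
      rcases hx with rfl | rfl
      exacts [hl v, hr v]
    exact exp_chord_sides (h.lt u (by simp)) (by linarith [hr u]) (by linarith [hl u])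
      (by linarith [hl u, hr u])

/-- Every interval `[l v, r v]` with `v` in `A` has a point of `C` in its interior. -/
def IsPierced {V : Type*} (A : Finset V) (l r : V → ℝ) (C : Finset ℝ) : Prop :=
  ∀ v ∈ A, ∃ c ∈ C, l v < c ∧ c < r v

lemma exists_bound {V : Type*} (A : Finset V) (l r : V → ℝ) (C : Finset ℝ) (K : ℝ) :
    ∃ M, K < M ∧ (∀ v ∈ A, |l v| < M ∧ |r v| < M) ∧ ∀ c ∈ C, |c| < M := by
  classical
  obtain ⟨M, hM⟩ := Finset.exists_le
    (A.image (fun v => |l v|) ∪ A.image (fun v => |r v|) ∪ C.image (fun c => |c|))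
  have hM1 : ∀ v ∈ A, |l v| ≤ M := fun v hv => hM _ (by simp; grind)
  have hM2 : ∀ v ∈ A, |r v| ≤ M := fun v hv => hM _ (by simp; grind)
  have hM3 : ∀ c ∈ C, |c| ≤ M := fun c hc => hM _ (by simp; grind)
  refine ⟨max M K + 1, ?_, fun v hv => ⟨?_, ?_⟩, fun c hc => ?_⟩
  · linarith [le_max_right M K]
  · linarith [le_max_left M K, hM1 v hv]
  · linarith [le_max_left M K, hM2 v hv]
  · linarith [le_max_left M K, hM3 c hc]

/-- Moving the endpoints smaller than `z` behind all others keeps an interval model an interval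
model: it moves the point at which the circle is cut open. -/
lemma IsIntervalModel.exists_rotate {V : Type*} {G : SimpleGraph V} {A : Finset V} {l r : V → ℝ}
    (h : IsIntervalModel G A l r) (z : ℝ) :
    ∃ (l' r' : V → ℝ) (M : ℝ), IsIntervalModel G A l' r' ∧
      (∀ v ∈ A, ∀ w ∈ A, l v < l w + M ∧ l v < r w + M ∧ r v < l w + M ∧ r v < r w + M) ∧
      ∀ v ∈ A, (r v < z → l' v = l v + M ∧ r' v = r v + M) ∧
        (l v < z → z ≤ r v → l' v = r v ∧ r' v = l v + M) ∧
        (z ≤ l v → l' v = l v ∧ r' v = r v) := by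
  classical
  obtain ⟨B, -, hB, -⟩ := exists_bound A l r ∅ 0
  let l' : V → ℝ := fun v => if r v < z then l v + 2 * B else if l v < z then r v else l v
  let r' : V → ℝ := fun v => if r v < z then r v + 2 * B else if l v < z then l v + 2 * B else r v
  have hM : ∀ v ∈ A, ∀ w ∈ A, l v < l w + 2 * B ∧ l v < r w + 2 * B ∧ r v < l w + 2 * B ∧
      r v < r w + 2 * B := by
    intro v hv w hw
    have h1 := abs_lt.1 (hB v hv).1
    have h2 := abs_lt.1 (hB v hv).2
    have h3 := abs_lt.1 (hB w hw).1
    have h4 := abs_lt.1 (hB w hw).2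
    refine ⟨?_, ?_, ?_, ?_⟩ <;> linarith
  have hc : ∀ v ∈ A, (r v < z ∧ l' v = l v + 2 * B ∧ r' v = r v + 2 * B) ∨
      (l v < z ∧ z ≤ r v ∧ l' v = r v ∧ r' v = l v + 2 * B) ∨
      (z ≤ l v ∧ l' v = l v ∧ r' v = r v) := by
    intro v hv
    have hlt := h.lt v hv
    by_cases h1 : r v < z
    · exact .inl ⟨h1, by simp [l', h1], by simp [r', h1]⟩
    · by_cases h2 : l v < z
      · exact .inr (.inl ⟨h2, not_lt.1 h1, by simp [l', h1, h2], by simp [r', h1, h2]⟩)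
      · exact .inr (.inr ⟨not_lt.1 h2, by simp [l', h1, h2], by simp [r', h1, h2]⟩)
  refine ⟨l', r', 2 * B, ⟨?_, ?_, ?_, ?_, ?_⟩, hM, ?_⟩
  · intro v hv
    have := h.lt v hv
    have := hM v hv v hv
    rcases hc v hv with ⟨h1, h2, h3⟩ | ⟨h1, h1', h2, h3⟩ | ⟨h1, h2, h3⟩ <;> rw [h2, h3] <;>
      linarith
  · intro u hu v hv huv
    have := hM v hv u hu
    have := hM u hu v hv
    have := h.left_ne u hu v hv huv
    have := h.right_ne u hu v hv huv
    have := h.left_ne_right u hu v hv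
    have := h.left_ne_right v hv u hu
    rcases hc v hv with ⟨h1, h2, h3⟩ | ⟨h1, h1', h2, h3⟩ | ⟨h1, h2, h3⟩ <;>
    rcases hc u hu with ⟨i1, i2, i3⟩ | ⟨i1, i1', i2, i3⟩ | ⟨i1, i2, i3⟩ <;>
    rw [h2, i2] <;> grind
  · intro u hu v hv huv
    have := hM v hv u hu
    have := hM u hu v hv
    have := h.left_ne u hu v hv huv
    have := h.right_ne u hu v hv huv
    have := h.left_ne_right u hu v hv
    have := h.left_ne_right v hv u hu
    rcases hc v hv with ⟨h1, h2, h3⟩ | ⟨h1, h1', h2, h3⟩ | ⟨h1, h2, h3⟩ <;>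
    rcases hc u hu with ⟨i1, i2, i3⟩ | ⟨i1, i1', i2, i3⟩ | ⟨i1, i2, i3⟩ <;>
    rw [h3, i3] <;> grind
  · intro u hu v hv
    have := hM v hv u hu
    have := hM u hu v hv
    have := h.left_ne_right u hu v hv
    have := h.left_ne_right v hv u hu
    have := h.lt u hu
    by_cases huv : u = v
    · subst huv
      rcases hc u hu with ⟨i1, i2, i3⟩ | ⟨i1, i1', i2, i3⟩ | ⟨i1, i2, i3⟩ <;>
      rw [i2, i3] <;> grind
    have := h.left_ne u hu v hv huv
    have := h.right_ne u hu v hv huv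
    rcases hc v hv with ⟨h1, h2, h3⟩ | ⟨h1, h1', h2, h3⟩ | ⟨h1, h2, h3⟩ <;>
    rcases hc u hu with ⟨i1, i2, i3⟩ | ⟨i1, i1', i2, i3⟩ | ⟨i1, i2, i3⟩ <;>
    rw [h3, i2] <;> grind
  · intro u hu v hv huv
    rw [h.adj_iff u hu v hv huv]
    have a1 := hM v hv u hu
    have a2 := hM u hu v hv
    have a3 := h.left_ne_right u hu v hv
    have a4 := h.left_ne_right v hv u hu
    have a5 := h.lt u hu
    have a6 := h.lt v hv
    have a7 := h.left_ne u hu v hv huv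
    have a8 := h.right_ne u hu v hv huv
    clear_value l' r'
    unfold Overlap
    rcases hc v hv with ⟨h1, h2, h3⟩ | ⟨h1, h1', h2, h3⟩ | ⟨h1, h2, h3⟩ <;>
    rcases hc u hu with ⟨i1, i2, i3⟩ | ⟨i1, i1', i2, i3⟩ | ⟨i1, i2, i3⟩ <;>
    rw [h2, h3, i2, i3] <;> clear hM hc hB h <;> grind
  · intro v hv
    have := h.lt v hv
    rcases hc v hv with ⟨h1, h2, h3⟩ | ⟨h1, h1', h2, h3⟩ | ⟨h1, h2, h3⟩ <;> rw [h2, h3] <;> grind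

lemma exists_gap_below {V : Type*} (A : Finset V) (l r : V → ℝ) {x y : ℝ} (hxy : x < y) :
    ∃ h, x < h ∧ h < y ∧ ∀ v ∈ A, (l v < y → l v < h) ∧ (r v < y → r v < h) := by
  classical
  induction A using Finset.induction_on with
  | empty => exact ⟨(x + y) / 2, by linarith, by linarith, by simp⟩
  | insert a A ha ih =>
    obtain ⟨h, h1, h2, h3⟩ := ih
    have h4 : max h (max (if l a < y then l a else x) (if r a < y then r a else x)) < y := by
      refine max_lt h2 (max_lt ?_ ?_) <;> split_ifs <;> assumption
    obtain ⟨k, hk1, hk2⟩ := exists_between h4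
    refine ⟨k, h1.trans ((le_max_left _ _).trans_lt hk1), hk2, ?_⟩
    simp only [max_lt_iff] at hk1
    intro v hv
    rcases Finset.mem_insert.1 hv with rfl | hv
    · refine ⟨fun e => ?_, fun e => ?_⟩
      · simpa [e] using hk1.2.1
      · simpa [e] using hk1.2.2
    · exact ⟨fun e => ((h3 v hv).1 e).trans hk1.1, fun e => ((h3 v hv).2 e).trans hk1.1⟩

lemma exists_gap_above {V : Type*} (A : Finset V) (l r : V → ℝ) {x y : ℝ} (hxy : y < x) :
    ∃ h, y < h ∧ h < x ∧ ∀ v ∈ A, (y < l v → h < l v) ∧ (y < r v → h < r v) := by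
  obtain ⟨h, h1, h2, h3⟩ := exists_gap_below A (fun v => - l v) (fun v => - r v) (neg_lt_neg hxy)
  refine ⟨-h, by linarith, by linarith, fun v hv => ⟨fun e => ?_, fun e => ?_⟩⟩
  · linarith [(h3 v hv).1 (neg_lt_neg e)]
  · linarith [(h3 v hv).2 (neg_lt_neg e)]

/-! ### Leaves and stars -/

/-- `[a, b]` is a hat over `u`: of the endpoints of the intervals with index in `A`, it contains
exactly one, and that belongs to `u`; moreover it has a point of `C` in its interior. An interval
drawn inside `[a, b]` close to its ends overlaps the interval of `u` only. -/
structure IsHat {V : Type*} (A : Finset V) (l r : V → ℝ) (C : Finset ℝ) (u : V) (a b : ℝ) :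
    Prop where
  corner : ∃ c ∈ C, a < c ∧ c < b
  self : (a < l u ∧ l u < b ∧ b < r u) ∨ (l u < a ∧ a < r u ∧ r u < b)
  other : ∀ v ∈ A, v ≠ u → (l v < a ∨ b < l v) ∧ (r v < a ∨ b < r v)

lemma IsHat.mono {V : Type*} {A : Finset V} {l r : V → ℝ} {C D : Finset ℝ} {u : V} {a b : ℝ}
    (h : IsHat A l r C u a b) (hCD : C ⊆ D) : IsHat A l r D u a b :=
  ⟨let ⟨c, hc, h'⟩ := h.corner; ⟨c, hCD hc, h'⟩, h.self, h.other⟩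

lemma IsIntervalModel.update_insert {V : Type*} [DecidableEq V] {G : SimpleGraph V} {A : Finset V}
    {l r : V → ℝ} (h : IsIntervalModel G A l r) {v : V} (hv : v ∉ A) {α β : ℝ} (hαβ : α < β)
    (hne : ∀ w ∈ A, α ≠ l w ∧ α ≠ r w ∧ β ≠ l w ∧ β ≠ r w)
    (hadj : ∀ w ∈ A, G.Adj v w ↔ (α < l w ∧ l w < β ∧ β < r w) ∨ (l w < α ∧ α < r w ∧ r w < β)) :
    IsIntervalModel G (insert v A) (Function.update l v α) (Function.update r v β) := by
  have hw : ∀ w ∈ A, Function.update l v α w = l w ∧ Function.update r v β w = r w := by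
    intro w hw
    have : w ≠ v := fun e => hv (e ▸ hw)
    simp [this]
  have h1 : Function.update l v α v = α := by simp
  have h2 : Function.update r v β v = β := by simp
  generalize Function.update l v α = l' at *
  generalize Function.update r v β = r' at *
  have hlt := h.lt
  have hl := h.left_ne
  have hr := h.right_ne
  have hlr := h.left_ne_right
  have had := h.adj_iff
  refine ⟨?_, ?_, ?_, ?_, ?_⟩
  · grind
  · grind
  · grind
  · grind
  · intro a ha b hb hab
    unfold Overlap
    rcases Finset.mem_insert.1 ha with rfl | ha' <;> rcases Finset.mem_insert.1 hb with rfl | hb'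
    · exact (hab rfl).elim
    · rw [h1, h2, (hw b hb').1, (hw b hb').2, hadj b hb']
    · rw [h1, h2, (hw a ha').1, (hw a ha').2, G.adj_comm, hadj a ha']
      exact or_comm
    · rw [(hw b hb').1, (hw b hb').2, (hw a ha').1, (hw a ha').2, had a ha' b hb' hab]
      rfl

lemma IsPierced.update_insert {V : Type*} [DecidableEq V] {A : Finset V} {l r : V → ℝ} {C : Finset ℝ}
    (h : IsPierced A l r C) {v : V} {α β : ℝ} (hv : v ∉ A) (hc : ∃ c ∈ C, α < c ∧ c < β) :
    IsPierced (insert v A) (Function.update l v α) (Function.update r v β) C := by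
  intro w hw
  rcases Finset.mem_insert.1 hw with rfl | hw
  · simpa using hc
  · have : w ≠ v := fun e => hv (e ▸ hw)
    simpa [this] using h w hw

/-- The outermost interval may be used for an isolated vertex. -/
lemma IsIntervalModel.exists_insert_isolated {V : Type*} [DecidableEq V] {G : SimpleGraph V}
    {A : Finset V} {l r : V → ℝ} (h : IsIntervalModel G A l r) {C : Finset ℝ}
    (hC : IsPierced A l r C) (hne : C.Nonempty) {z : V} (hz : z ∉ A)
    (hadj : ∀ w ∈ A, ¬ G.Adj z w) :
    ∃ l' r', IsIntervalModel G (insert z A) l' r' ∧ IsPierced (insert z A) l' r' C ∧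
      ∀ w ∈ A, l' z < l' w := by
  obtain ⟨M, hM0, hM, hMC⟩ := exists_bound A l r C 0
  obtain ⟨c, hc⟩ := hne
  refine ⟨Function.update l z (-M), Function.update r z M,
    h.update_insert hz (by linarith) ?_ ?_, hC.update_insert hz ⟨c, hc, abs_lt.1 (hMC c hc)⟩, ?_⟩
  · intro w hw
    have h1 := abs_lt.1 (hM w hw).1
    have h2 := abs_lt.1 (hM w hw).2
    exact ⟨h1.1.ne, h2.1.ne, h1.2.ne', h2.2.ne'⟩
  · intro w hw
    have h1 := abs_lt.1 (hM w hw).1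
    have h2 := abs_lt.1 (hM w hw).2
    have := hadj w hw
    grind
  · intro w hw
    have : w ≠ z := fun e => hz (e ▸ hw)
    have h1 := abs_lt.1 (hM w hw).1
    simpa [this] using h1.1

/-- Leaves attached to the vertex `z` whose interval begins first: their intervals begin directly
after the beginning of that of `z`, and end behind all others. -/
lemma IsIntervalModel.exists_union_leaves_of_first {V : Type*} [DecidableEq V]
    {G : SimpleGraph V} {A : Finset V} {l r : V → ℝ} (h : IsIntervalModel G A l r)
    {C : Finset ℝ} (hC : IsPierced A l r C) {z : V} (hz : z ∈ A)
    (hfirst : ∀ w ∈ A, w ≠ z → l z < l w) (N : Finset V) (hN : Disjoint N A)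
    (hadj : ∀ v ∈ N, ∀ w ∈ A ∪ N, G.Adj v w ↔ w = z) :
    ∃ l' r', IsIntervalModel G (A ∪ N) l' r' ∧ IsPierced (A ∪ N) l' r' C ∧
      ∀ w ∈ A ∪ N, w ≠ z → l' z < l' w := by
  induction N using Finset.induction_on with
  | empty => exact ⟨l, r, by simpa using h, by simpa using hC, by simpa using hfirst⟩
  | insert v N hv ih =>
    obtain ⟨l', r', h', hC', hf'⟩ := ih (by grind) (by grind)
    have hv' : v ∉ A ∪ N := by grind
    have hz' : z ∈ A ∪ N := by grind
    obtain ⟨c, hc, hc1, hc2⟩ := hC' z hz'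
    obtain ⟨M, -, hM, hMC⟩ := exists_bound (A ∪ N) l' r' C 0
    obtain ⟨α, ha1, ha2, ha3⟩ := exists_gap_above (A ∪ N) l' r' hc1
    have hcM := abs_lt.1 (hMC c hc)
    rw [show A ∪ insert v N = insert v (A ∪ N) by grind]
    refine ⟨Function.update l' v α, Function.update r' v M,
      h'.update_insert hv' (by linarith) ?_ ?_, hC'.update_insert hv' ⟨c, hc, ha2, hcM.2⟩, ?_⟩
    · intro w hw
      have h1 := abs_lt.1 (hM w hw).1
      have h2 := abs_lt.1 (hM w hw).2
      have h3 := ha3 w hw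
      have h4 := h'.lt w hw
      by_cases hwz : w = z
      · subst hwz; grind
      · have := hf' w hw hwz; grind
    · intro w hw
      have h1 := abs_lt.1 (hM w hw).1
      have h2 := abs_lt.1 (hM w hw).2
      have h3 := ha3 w hw
      have h4 := h'.lt w hw
      rw [hadj v (by simp) w (by grind)]
      by_cases hwz : w = z
      · subst hwz; grind
      · have := hf' w hw hwz; grind
    · have hzv : z ≠ v := by grind
      intro w hw hwz
      rcases Finset.mem_insert.1 hw with rfl | hw
      · simpa [hzv] using ha1
      · have : w ≠ v := fun e => hv' (e ▸ hw)
        simpa [this, hzv] using hf' w hw hwz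

/-- Leaves attached to vertices with pairwise disjoint hats. -/
lemma IsIntervalModel.exists_union_leaves_of_hats {V : Type*} [DecidableEq V]
    {G : SimpleGraph V} {A : Finset V} {l r : V → ℝ} (h : IsIntervalModel G A l r)
    {C : Finset ℝ} (hC : IsPierced A l r C) {P : Finset V} (hP : P ⊆ A) {a b : V → ℝ}
    (hhat : ∀ u ∈ P, IsHat A l r C u (a u) (b u))
    (hdisj : ∀ u ∈ P, ∀ v ∈ P, u ≠ v → b u < a v ∨ b v < a u)
    (N : Finset V) (hN : Disjoint N A)
    (hadj : ∀ v ∈ N, ∃ u ∈ P, ∀ w ∈ A ∪ N, G.Adj v w ↔ w = u) :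
    ∃ l' r', IsIntervalModel G (A ∪ N) l' r' ∧ IsPierced (A ∪ N) l' r' C ∧
      (∀ v ∈ A, l' v = l v ∧ r' v = r v) ∧ ∀ v ∈ N, ∃ u ∈ P, a u < l' v := by
  suffices H : ∃ l' r' a' b' : V → ℝ, IsIntervalModel G (A ∪ N) l' r' ∧ IsPierced (A ∪ N) l' r' C ∧
      (∀ v ∈ A, l' v = l v ∧ r' v = r v) ∧ (∀ v ∈ N, ∃ u ∈ P, a u < l' v) ∧
      (∀ u ∈ P, IsHat (A ∪ N) l' r' C u (a' u) (b' u)) ∧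
      ∀ u ∈ P, a u ≤ a' u ∧ b' u ≤ b u ∧ a' u ≤ b' u by
    obtain ⟨l', r', -, -, h1, h2, h3, h4, -⟩ := H
    exact ⟨l', r', h1, h2, h3, h4⟩
  induction N using Finset.induction_on with
  | empty =>
    refine ⟨l, r, a, b, by simpa using h, by simpa using hC, by simp, by simp,
      by simpa using hhat, fun u hu => ⟨le_rfl, le_rfl, ?_⟩⟩
    obtain ⟨c, -, h1, h2⟩ := (hhat u hu).corner
    linarith
  | insert v N hv ih =>
    obtain ⟨l', r', a', b', h', hC', hag, hbd, hhat', hnest⟩ := ih (by grind) fun x hx =>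
      let ⟨u, hu, hux⟩ := hadj x (by simp [hx])
      ⟨u, hu, fun w hw => hux w (by grind)⟩
    have hv' : v ∉ A ∪ N := by grind
    obtain ⟨u, hu, huadj⟩ := hadj v (by simp)
    have hu' : u ∈ A ∪ N := by grind
    obtain ⟨⟨c, hc, hc1, hc2⟩, hself, hother⟩ := hhat' u hu
    -- the endpoint of `u` in the hat
    obtain ⟨e, he1, he2, he⟩ : ∃ e, a' u < e ∧ e < b' u ∧
        (e = l' u ∧ b' u < r' u ∨ e = r' u ∧ l' u < a' u) := by
      rcases hself with ⟨s1, s2, s3⟩ | ⟨s1, s2, s3⟩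
      · exact ⟨_, s1, s2, .inl ⟨rfl, s3⟩⟩
      · exact ⟨_, s2, s3, .inr ⟨rfl, s1⟩⟩
    obtain ⟨α', hα1, hα2⟩ := exists_between (lt_min hc1 he1)
    obtain ⟨α, hα3, hα4⟩ := exists_between hα1
    obtain ⟨β', hβ1, hβ2⟩ := exists_between (max_lt hc2 he2)
    obtain ⟨β, hβ3, hβ4⟩ := exists_between hβ2
    rw [lt_min_iff] at hα2
    rw [max_lt_iff] at hβ1
    have hne : ∀ w ∈ A ∪ N, w ≠ v := fun w hw e => hv' (e ▸ hw)
    rw [show A ∪ insert v N = insert v (A ∪ N) by grind]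
    refine ⟨Function.update l' v α, Function.update r' v β, Function.update a' u α',
      Function.update b' u β', h'.update_insert hv' (by linarith) ?_ ?_,
      hC'.update_insert hv' ⟨c, hc, by linarith, by linarith⟩, ?_, ?_, ?_, ?_⟩
    · intro w hw
      have := h'.lt w hw
      by_cases hwu : w = u
      · subst hwu; grind
      · have := hother w hw hwu; grind
    · intro w hw
      rw [huadj w (by grind)]
      have := h'.lt w hw
      by_cases hwu : w = u
      · subst hwu; grind
      · have := hother w hw hwu; grind
    · intro w hw
      have := hne w (by grind)
      simpa [this] using hag w hw
    · intro w hw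
      rcases Finset.mem_insert.1 hw with rfl | hw
      · exact ⟨u, hu, by simpa using (hnest u hu).1.trans_lt hα3⟩
      · have := hne w (by grind)
        simpa [this] using hbd w hw
    · intro t ht
      have htv := hne t (by grind)
      by_cases htu : t = u
      · subst htu
        refine ⟨⟨c, hc, by simpa using hα2.1, by simpa using hβ1.1⟩, ?_, ?_⟩
        · simp only [Function.update_self, Function.update_of_ne htv]
          grind
        · intro w hw hwt
          rcases Finset.mem_insert.1 hw with rfl | hw
          · simp only [Function.update_self]; grind
          · have := hother w hw hwt
            simp only [Function.update_self, Function.update_of_ne (hne w hw)]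
            grind
      · obtain ⟨k1, k2, k3⟩ := hhat' t ht
        refine ⟨by simpa [htu] using k1, by simpa [htu, htv] using k2, ?_⟩
        intro w hw hwt
        rcases Finset.mem_insert.1 hw with rfl | hw
        · have := hdisj t ht u hu htu
          have := hnest t ht
          have := hnest u hu
          simp only [Function.update_self, Function.update_of_ne htu]
          grind
        · simpa [htu, hne w hw] using k3 w hw hwt
    · intro t ht
      have := hnest t ht
      by_cases htu : t = u
      · subst htu
        simp only [Function.update_self]
        refine ⟨?_, ?_, ?_⟩ <;> linarith
      · simpa [htu] using this

/-! ### Piercing the intervals greedily -/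

section Greedy
variable {V : Type*} [DecidableEq V]

/-- The budget for the part of the line to the right of `x`. The vertices in `U` (for which a hat
is still wanted) count four, and those in `F` (which already have a hat) count one if their
right end is to come. Any other vertex counts one for each end to come, and `d v` in addition
if its interval has not yet begun: an allowance for a vertex with `2 - d v` neighbours only. A
point is paid for with four units. -/
noncomputable def greedyWeight (l r : V → ℝ) (d : V → ℕ) (x : ℝ) (U F : Finset V) (v : V) : ℕ :=
  if v ∈ U then 4 else if v ∈ F then (if x < r v then 1 else 0) else
    (if x < l v then 1 + d v else 0) + (if x < r v then 1 else 0)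

lemma greedyWeight_le (l r : V → ℝ) (d : V → ℕ) {x x' : ℝ} (hx : x ≤ x') (U F : Finset V)
    (v : V) : greedyWeight l r d x' U F v ≤ greedyWeight l r d x U F v := by
  unfold greedyWeight
  split_ifs <;> first | omega | (exfalso; linarith)

lemma greedyWeight_move_le (l r : V → ℝ) (d : V → ℕ) {x x' : ℝ} (hx : x ≤ x') (U F : Finset V)
    {u v : V} (huv : v ≠ u) :
    greedyWeight l r d x' (U.erase u) (insert u F) v ≤ greedyWeight l r d x U F v := by
  refine le_trans (le_of_eq ?_) (greedyWeight_le l r d hx U F v)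
  simp [greedyWeight, huv]

/-- Greedy scan from left to right, starting at `x`: the next point is placed as late as possible
before the first end of an interval that still needs a point or a hat, except that it is moved
back to an earlier beginning of an interval in `U` where it helps to make a hat. -/
theorem IsIntervalModel.exists_greedy {G : SimpleGraph V} {R : Finset V} {l r : V → ℝ}
    (h : IsIntervalModel G R l r) [DecidableRel G.Adj] (d : V → ℕ) :
    ∀ (N : ℕ) (x : ℝ) (U F : Finset V), U ⊆ R → (∀ u ∈ U, x < r u) → (∀ f ∈ F, l f ≤ x) →
      (∀ s ∈ R, s ∉ U → s ∉ F → 2 ≤ d s + (R.filter (G.Adj s)).card) →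
      ∑ v ∈ R, greedyWeight l r d x U F v ≤ N →
      ∃ (C : Finset ℝ) (a b : V → ℝ), 4 * C.card ≤ N ∧
        (∀ v ∈ R, v ∉ F → (v ∈ U ∨ x < l v) → ∃ c ∈ C, l v < c ∧ c < r v) ∧
        (∀ u ∈ U, IsHat R l r C u (a u) (b u) ∧ x < a u) ∧
        ∀ u ∈ U, ∀ v ∈ U, u ≠ v → b u < a v ∨ b v < a u := by
  intro N
  induction N using Nat.strong_induction_on with
  | _ N ih =>
  intro x U F hUR hU hF hdeg hN
  have hlt := h.lt
  have hll := h.left_ne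
  have hrr := h.right_ne
  have hlr := h.left_ne_right
  -- recursive call, after the budget has been reduced by `g`
  have step : ∀ (x' : ℝ) (U' F' : Finset V) (g : V → ℕ), U' ⊆ R → (∀ u ∈ U', x' < r u) →
      (∀ f ∈ F', l f ≤ x') → (∀ s ∈ R, s ∉ U' → s ∉ F' → s ∉ U ∧ s ∉ F) →
      4 ≤ ∑ v ∈ R, g v →
      (∀ v ∈ R, greedyWeight l r d x' U' F' v + g v ≤ greedyWeight l r d x U F v) →
      ∃ (C : Finset ℝ) (a b : V → ℝ), 4 * C.card + 4 ≤ N ∧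
        (∀ v ∈ R, v ∉ F' → (v ∈ U' ∨ x' < l v) → ∃ c ∈ C, l v < c ∧ c < r v) ∧
        (∀ u ∈ U', IsHat R l r C u (a u) (b u) ∧ x' < a u) ∧
        ∀ u ∈ U', ∀ v ∈ U', u ≠ v → b u < a v ∨ b v < a u := by
    intro x' U' F' g h1 h2 h3 h4 h5 h6
    have h7 := Finset.sum_le_sum h6
    rw [Finset.sum_add_distrib] at h7
    obtain ⟨C, a, b, k1, k2⟩ := ih (N - 4) (by omega) x' U' F' h1 h2 h3
      (fun s hs hs1 hs2 => hdeg s hs (h4 s hs hs1 hs2).1 (h4 s hs hs1 hs2).2) (by omega)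
    exact ⟨C, a, b, by omega, k2⟩
  -- the same, where the new point makes the hat `[α, β]` over `u`
  have stepHat : ∀ (u : V) (α c β : ℝ) (g : V → ℕ), u ∈ U → IsHat R l r {c} u α β →
      x < α → l u < c → c < r u → c < β → (∀ w ∈ U, w ≠ u → β < r w) → l u ≤ β →
      (∀ v ∈ R, v ∉ U → v ∉ F → x < l v → l v ≤ β → l v < c ∧ c < r v) →
      4 ≤ ∑ v ∈ R, g v →
      (∀ v ∈ R, greedyWeight l r d β (U.erase u) (insert u F) v + g v ≤
        greedyWeight l r d x U F v) →
      ∃ (C : Finset ℝ) (a b : V → ℝ), 4 * C.card ≤ N ∧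
        (∀ v ∈ R, v ∉ F → (v ∈ U ∨ x < l v) → ∃ c ∈ C, l v < c ∧ c < r v) ∧
        (∀ u ∈ U, IsHat R l r C u (a u) (b u) ∧ x < a u) ∧
        ∀ u ∈ U, ∀ v ∈ U, u ≠ v → b u < a v ∨ b v < a u := by
    intro u α c β g hu hhat hxα hc1 hc2 hcβ hβ hluβ hp hg hw
    obtain ⟨c', hc', hα1, hα2⟩ := hhat.corner
    have hαβ : α < β := hα1.trans hα2
    obtain ⟨C, a, b, k1, k2, k3, k4⟩ := step β (U.erase u) (insert u F) g
      ((Finset.erase_subset _ _).trans hUR)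
      (fun w hw => hβ w (Finset.mem_of_mem_erase hw) (Finset.ne_of_mem_erase hw))
      (fun f hf => by
        rcases Finset.mem_insert.1 hf with rfl | hf
        · exact hluβ
        · linarith [hF f hf])
      (fun s _ h1 h2 => by grind) hg hw
    refine ⟨insert c C, Function.update a u α, Function.update b u β, ?_, ?_, ?_, ?_⟩
    · have := Finset.card_insert_le c C
      omega
    · intro v hv hvF hvx
      by_cases hvu : v = u
      · subst hvu
        exact ⟨c, by simp, hc1, hc2⟩
      by_cases hv' : v ∈ U ∨ β < l v
      · obtain ⟨e, he, he'⟩ := k2 v hv (by grind) (by grind)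
        exact ⟨e, by simp [he], he'⟩
      · exact ⟨c, by simp, by grind⟩
    · intro w hw
      by_cases hwu : w = u
      · subst hwu
        simpa [hxα] using hhat.mono (D := insert c C) (by simp)
      · have := k3 w (by grind)
        simp only [Function.update_of_ne hwu]
        exact ⟨this.1.mono (by simp), by linarith⟩
    · intro w hw v hv hwv
      by_cases hwu : w = u
      · subst hwu
        have := k3 v (by grind)
        simp only [Function.update_self, Function.update_of_ne hwv.symm]
        exact .inl this.2
      · by_cases hvu : v = u
        · subst hvu
          have := k3 w (by grind)
          simp only [Function.update_self, Function.update_of_ne hwv]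
          exact .inr this.2
        · simpa [hwu, hvu] using k4 w (by grind) v (by grind) hwv
  by_cases hD : (R.filter fun v => v ∈ U ∨ v ∉ F ∧ x < l v).Nonempty
  swap
  · rw [Finset.not_nonempty_iff_eq_empty, Finset.filter_eq_empty_iff] at hD
    refine ⟨∅, l, l, by simp, fun v hv h1 h2 => ?_, fun u hu => ?_, fun u hu => ?_⟩
    · exact (hD hv (by tauto)).elim
    · exact (hD (hUR hu) (by tauto)).elim
    · exact (hD (hUR hu) (by tauto)).elim
  obtain ⟨s, hs, hmin⟩ := Finset.exists_min_image _ r hD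
  rw [Finset.mem_filter] at hs
  obtain ⟨hsR, hs⟩ := hs
  replace hmin : ∀ v ∈ R, (v ∈ U ∨ v ∉ F ∧ x < l v) → v ≠ s → r s < r v := fun v hv hv' hvs =>
    lt_of_le_of_ne (hmin v (by simp [hv, hv'])) (hrr s hsR v hv hvs.symm)
  by_cases hsU : s ∈ U
  · -- the right end of a vertex that needs a hat comes first
    obtain ⟨α, ha1, ha2, ha3⟩ := exists_gap_below R l r (max_lt (hU s hsU) (hlt s hsR))
    obtain ⟨β, hb1, -, hb3⟩ := exists_gap_above R l r (lt_add_one (r s))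
    obtain ⟨c, hc1, hc2⟩ := exists_between ha2
    rw [max_lt_iff] at ha1
    refine stepHat s α c β (fun v => if v = s then 4 else 0) hsU
      ⟨⟨c, by simp, hc1, by linarith⟩, .inr ⟨ha1.2, ha2, hb1⟩, ?_⟩ ha1.1 (by linarith) hc2
      (by linarith) ?_ (by linarith) ?_ ?_ ?_
    · intro v hv hvs
      have := hlr v hv s hsR
      have := hrr v hv s hsR hvs
      have := ha3 v hv
      have := hb3 v hv
      grind
    · intro w hw hws
      have := hmin w (hUR hw) (.inl hw) hws
      have := hb3 w (hUR hw)
      grind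
    · intro v hv hvU hvF hxv hvβ
      have hvs : v ≠ s := fun e => hvU (e ▸ hsU)
      have := hmin v hv (.inr ⟨hvF, hxv⟩) hvs
      have := hlr v hv s hsR
      have := ha3 v hv
      have := hb3 v hv
      grind
    · simp [hsR]
    · intro v hv
      by_cases hvs : v = s
      · subst hvs
        simp [greedyWeight, hsU, hb1.le]
      · simpa [hvs] using greedyWeight_move_le l r d (by linarith : x ≤ β) U F hvs
  obtain ⟨hsF, hxs⟩ : s ∉ F ∧ x < l s := by tauto
  have hws : greedyWeight l r d x U F s = 2 + d s := by
    have : x < r s := hxs.trans (hlt s hsR)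
    simp [greedyWeight, hsU, hsF, hxs, this]; omega
  by_cases hex : ∃ u ∈ U, l s < l u ∧ l u < r s
  · -- the interval that ends first has in it the beginning of a vertex that needs a hat
    obtain ⟨u, hu, hu1, hu2⟩ := hex
    have huR := hUR hu
    have hus : u ≠ s := fun e => hsU (e ▸ hu)
    obtain ⟨α, ha1, ha2, ha3⟩ := exists_gap_below R l r hu1
    obtain ⟨β, hb1, hb2, hb3⟩ := exists_gap_above R l r hu2
    obtain ⟨c, hc1, hc2⟩ := exists_between hb1
    have hru : r s < r u := hmin u huR (.inl hu) hus
    refine stepHat u α c β (fun v => if v = s then 1 else if v = u then 3 else 0) hu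
      ⟨⟨c, by simp, by linarith, hc2⟩, .inl ⟨ha2, hb1, by linarith⟩, ?_⟩ (by linarith) hc1
      (by linarith) hc2 ?_ hb1.le ?_ ?_ ?_
    · intro v hv hvu
      have := hll v hv u huR hvu
      have := hlr u huR v hv
      have := ha3 v hv
      have := hb3 v hv
      grind
    · intro w hw hws
      have := hmin w (hUR hw) (.inl hw) (fun e => hsU (e ▸ hw))
      linarith
    · intro v hv hvU hvF hxv hvβ
      have hvu : v ≠ u := fun e => hvU (e ▸ hu)
      have := hll v hv u huR hvu
      have := hb3 v hv
      have : r s ≤ r v := by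
        by_cases hvs : v = s
        · rw [hvs]
        · exact (hmin v hv (.inr ⟨hvF, hxv⟩) hvs).le
      grind
    · rw [← Finset.add_sum_erase R _ hsR,
        ← Finset.add_sum_erase (R.erase s) _ (Finset.mem_erase.2 ⟨hus, huR⟩)]
      simp [hus]
      omega
    · intro v hv
      by_cases hvs : v = s
      · subst hvs
        rw [hws]
        have : ¬ β < l v := by linarith
        simp [greedyWeight, hsU, hsF, hus.symm, this]
        split_ifs <;> omega
      · by_cases hvu : v = u
        · subst hvu
          simp [greedyWeight, hu, hus]
          split_ifs <;> omega
        · simpa [hvs, hvu] using greedyWeight_move_le l r d (by linarith : x ≤ β) U F hvu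
  · -- otherwise all intervals that overlap it have a unit to spend there
    push Not at hex
    obtain ⟨c, hc1, hc2, hc3⟩ := exists_gap_below R l r (hlt s hsR)
    let g : V → ℕ := fun v => if v = s then 2 + d s else if G.Adj s v then 1 else 0
    have hg : 4 ≤ ∑ v ∈ R, g v := by
      have h1 := hdeg s hsR hsU hsF
      have h2 : (R.filter (G.Adj s)).card = ∑ v ∈ R.erase s, if G.Adj s v then 1 else 0 := by
        rw [← Finset.card_filter]
        congr 1
        ext v
        have := @SimpleGraph.ne_of_adj _ G s v
        simp only [Finset.mem_filter, Finset.mem_erase]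
        grind
      have h3 : ∑ v ∈ R.erase s, (if v = s then 2 + d s else if G.Adj s v then 1 else 0) =
          ∑ v ∈ R.erase s, if G.Adj s v then 1 else 0 :=
        Finset.sum_congr rfl fun v hv => by simp [Finset.ne_of_mem_erase hv]
      simp only [g]
      rw [← Finset.add_sum_erase R _ hsR, h3, ← h2, if_pos rfl]
      omega
    have hw : ∀ v ∈ R, greedyWeight l r d (r s) U F v + g v ≤ greedyWeight l r d x U F v := by
      intro v hv
      simp only [g]
      have hmono := greedyWeight_le l r d (by linarith [hlt s hsR] : x ≤ r s) U F v
      by_cases hvs : v = s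
      · subst hvs
        have := hlt v hsR
        have h1 : ¬ r v < l v := by linarith
        rw [hws]
        simp [greedyWeight, hsU, hsF, h1]
      · by_cases hadj : G.Adj s v
        · have ho := (h.adj_iff s hsR v hv (Ne.symm hvs)).1 hadj
          have hvU : v ∉ U := by
            intro hvU
            have h1 := hex v hvU
            have h2 := hmin v hv (.inl hvU) hvs
            rcases ho with ho | ho <;> grind
          by_cases hvF : v ∈ F
          · have h1 := hF v hvF
            have h2 : x < r v ∧ ¬ r s < r v := by
              rcases ho with ho | ho
              · exfalso; linarith
              · constructor <;> linarith
            simp [greedyWeight, hvU, hvF, hvs, hadj, h2]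
          · simp only [greedyWeight, hvU, hvF, if_false, hvs, hadj, if_true]
            rcases ho with ho | ho
            · have e1 : x < l v := by linarith
              have e2 : ¬ r s < l v := by linarith
              have e3 : x < r v := by linarith
              simp only [e1, e2, e3, if_true, if_false]
              split_ifs <;> omega
            · have e1 : ¬ r s < l v := by linarith
              have e2 : ¬ r s < r v := by linarith
              have e3 : x < r v := by linarith
              simp only [e1, e2, e3, if_true, if_false]
              omega
        · simpa [hvs, hadj] using hmono
    obtain ⟨C, a, b, k1, k2, k3, k4⟩ := step (r s) U F
      g hUR
      (fun u hu => hmin u (hUR hu) (.inl hu) (fun e => hsU (e ▸ hu)))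
      (fun f hf => by linarith [hF f hf, hlt s hsR]) (fun t _ h1 h2 => ⟨h1, h2⟩) hg hw
    refine ⟨insert c C, a, b, ?_, ?_, ?_, k4⟩
    · have := Finset.card_insert_le c C
      omega
    · intro v hv hvF hvx
      by_cases hv' : v ∈ U ∨ r s < l v
      · obtain ⟨e, he, he'⟩ := k2 v hv hvF hv'
        exact ⟨e, by simp [he], he'⟩
      · have := hc3 v hv
        have := hlr v hv s hsR
        refine ⟨c, by simp, by grind, ?_⟩
        by_cases hvs : v = s
        · rw [hvs]; exact hc2
        · have := hmin v hv (by grind) hvs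
          linarith
    · intro u hu
      have := k3 u hu
      have := hlt s hsR
      exact ⟨(k3 u hu).1.mono (by simp), by linarith⟩

end Greedy

/-! ### Few points pierce all intervals of a suitable model -/

section Core
variable {V : Type*} {G : SimpleGraph V} [DecidableRel G.Adj]

/-- Without vertices of degree at most one no hats are needed. Cutting the circle open at the end
of a chord disjoint from some other chord saves one unit, so that not all of the `2 n` units are
spent. -/
lemma IsIntervalModel.exists_pierced_of_two_le_degree [DecidableEq V]
    {A : Finset V} {l r : V → ℝ} (h : IsIntervalModel G A l r)
    (hdeg : ∀ s ∈ A, 2 ≤ (A.filter (G.Adj s)).card) :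
    ∃ (l' r' : V → ℝ) (C : Finset ℝ), IsIntervalModel G A l' r' ∧ IsPierced A l' r' C ∧
      C.Nonempty ∧ C.card ≤ max 1 ((A.card - 1) / 2) := by
  by_cases hcomp : ∀ v ∈ A, ∀ w ∈ A, v ≠ w → G.Adj v w
  · -- pairwise overlapping intervals have a common interior point
    rcases A.eq_empty_or_nonempty with rfl | hA
    · exact ⟨l, r, {0}, h, by simp [IsPierced], by simp, by simp⟩
    obtain ⟨v, hv, hvmax⟩ := Finset.exists_max_image A l hA
    obtain ⟨w, hw, hwmin⟩ := Finset.exists_min_image A r hA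
    have hvw : l v < r w := by
      by_cases e : v = w
      · exact e ▸ h.lt v hv
      · rcases (h.adj_iff v hv w hw e).1 (hcomp v hv w hw e) with ho | ho <;>
          linarith [h.lt w hw]
    obtain ⟨c, hc1, hc2⟩ := exists_between hvw
    exact ⟨l, r, {c}, h, fun u hu => ⟨c, by simp, (hvmax u hu).trans_lt hc1,
      hc2.trans_le (hwmin u hu)⟩, by simp, by simp⟩
  obtain ⟨v, hv, w, hw, hvw, hout⟩ : ∃ v ∈ A, ∃ w ∈ A, v ≠ w ∧
      (l w < l v ∨ r v < l w) ∧ (r w < l v ∨ r v < r w) := by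
    push Not at hcomp
    obtain ⟨v, hv, w, hw, hvw, hadj⟩ := hcomp
    rw [h.adj_iff v hv w hw hvw] at hadj
    have h1 := h.left_ne v hv w hw hvw
    have h2 := h.right_ne v hv w hw hvw
    have h3 := h.left_ne_right v hv w hw
    have h4 := h.left_ne_right w hw v hv
    have h5 := h.lt v hv
    have h6 := h.lt w hw
    by_cases hout : (l w < l v ∨ r v < l w) ∧ (r w < l v ∨ r v < r w)
    · exact ⟨v, hv, w, hw, hvw, hout⟩
    · refine ⟨w, hw, v, hv, hvw.symm, ?_⟩
      unfold Overlap at hadj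
      clear hdeg h
      grind
  -- cut the circle open directly before the right end of `v`
  obtain ⟨l', r', M, h', hM, hc⟩ := h.exists_rotate (r v)
  have hcv := (hc v hv).2.1 (h.lt v hv) le_rfl
  have hfirst : ∀ u ∈ A, u ≠ v → l' v < l' u := by
    intro u hu huv
    have h1 := hc u hu
    have h2 := hM v hv u hu
    have h3 := h.right_ne u hu v hv huv
    have h4 := h.left_ne_right u hu v hv
    clear hdeg h' hM hc
    grind
  have hlast : r' w < r' v := by
    have h1 := hc w hw
    have h2 := hM w hw v hv
    have h3 := h.lt w hw
    clear hdeg h' hM hc hfirst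
    grind
  obtain ⟨C, -, -, hC1, hC2, -⟩ := h'.exists_greedy (fun _ => 0) (2 * A.card - 1) (l' v) ∅ ∅
    (by simp) (by simp) (by simp) (by simpa using hdeg) (by
      have h1 : ∀ u ∈ A, greedyWeight l' r' (fun _ => 0) (l' v) ∅ ∅ u +
          (if u = v then 1 else 0) ≤ 2 := by
        intro u hu
        by_cases huv : u = v
        · subst huv
          simp [greedyWeight]
          split_ifs <;> omega
        · simp [greedyWeight, huv]
          split_ifs <;> omega
      have h2 := Finset.sum_le_sum h1
      rw [Finset.sum_add_distrib] at h2
      simp [hv] at h2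
      omega)
  -- the interval of `w` lies inside that of `v`, so the point that pierces it also pierces `v`
  obtain ⟨c, hcC, hcw⟩ := hC2 w hw (by simp) (.inr (hfirst w hw hvw.symm))
  refine ⟨l', r', C, h', fun u hu => ?_, ⟨c, hcC⟩, le_max_of_le_right (by omega)⟩
  by_cases huv : u = v
  · subst huv
    exact ⟨c, hcC, (hfirst w hw hvw.symm).trans hcw.1, hcw.2.trans hlast⟩
  · exact hC2 u hu (by simp) (.inr (hfirst u hu huv))

/-- The vertices in `P` are to get leaves. The circle is cut open directly before an end of the
vertex `z` in `P`, which makes the point of the cut usable for the leaves of `z`; in the greedy scan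
`z` then counts as a vertex without leaves, which may have one neighbour only. -/
lemma IsIntervalModel.exists_pierced_with_hats [DecidableEq V]
    {R : Finset V} {l r : V → ℝ} (h : IsIntervalModel G R l r) {P : Finset V} (hP : P ⊆ R)
    (hdeg : ∀ s ∈ R, s ∉ P → 2 ≤ (R.filter (G.Adj s)).card)
    {z : V} (hz : z ∈ P) (hdegz : 1 ≤ (R.filter (G.Adj z)).card) :
    ∃ (l' r' : V → ℝ) (C : Finset ℝ) (a b : V → ℝ), IsIntervalModel G R l' r' ∧
      IsPierced R l' r' C ∧ 4 * C.card ≤ 2 * (R.card + P.card) - 1 ∧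
      (∀ v ∈ R, v ≠ z → l' z < l' v) ∧
      (∀ u ∈ P.erase z, IsHat R l' r' C u (a u) (b u)) ∧
      ∀ u ∈ P.erase z, ∀ v ∈ P.erase z, u ≠ v → b u < a v ∨ b v < a u := by
  have hzR := hP hz
  obtain ⟨l', r', M, h', hM, hc⟩ := h.exists_rotate (l z)
  have hcz := (hc z hzR).2.2 le_rfl
  have hfirst : ∀ u ∈ R, u ≠ z → l' z < l' u := by
    intro u hu huz
    have h1 := hc u hu
    have h2 := hM z hzR u hu
    have h3 := h.left_ne u hu z hzR huz
    have h4 := h.left_ne_right z hzR u hu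
    clear hdeg h' hM hc
    grind
  have hfirst' : ∀ u ∈ R, l' z ≤ l' u := by
    intro u hu
    by_cases huz : u = z
    · rw [huz]
    · exact (hfirst u hu huz).le
  obtain ⟨C, a, b, hC1, hC2, hC3, hC4⟩ := h'.exists_greedy (fun v => if v = z then 1 else 0)
    (2 * (R.card + P.card) - 1) (l' z - 1) (P.erase z) ∅
    ((Finset.erase_subset _ _).trans hP)
    (fun u hu => by
      have huR := hP (Finset.mem_of_mem_erase hu)
      linarith [hfirst' u huR, h'.lt u huR]) (by simp)
    (fun s hs hsP _ => by
      by_cases hsz : s = z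
      · subst hsz
        simp only [if_true]; omega
      · have := hdeg s hs (by grind)
        omega)
    (by
      have h1 : ∀ u ∈ R, greedyWeight l' r' (fun v => if v = z then 1 else 0) (l' z - 1)
          (P.erase z) ∅ u + (if u = z then 1 else 0) ≤ 2 + (if u ∈ P then 2 else 0) := by
        intro u hu
        by_cases huz : u = z
        · subst huz
          simp [greedyWeight, hz]
          split_ifs <;> omega
        · simp [greedyWeight, huz]
          split_ifs <;> omega
      have h2 := Finset.sum_le_sum h1
      rw [Finset.sum_add_distrib, Finset.sum_add_distrib, ← Finset.sum_filter,
        ← Finset.sum_filter (· ∈ P), Finset.filter_mem_eq_inter, Finset.inter_eq_right.2 hP] at h2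
      simp [Finset.filter_eq', hzR] at h2
      omega)
  exact ⟨l', r', C, a, b, h', fun v hv => hC2 v hv (by simp)
    (.inr (by linarith [hfirst' v hv])), hC1, hfirst, fun u hu => (hC3 u hu).1, hC4⟩

end Core

/-- Together with the point at which the circle is cut open, `max 2 ⌈|A| / 2⌉` corners suffice. -/
theorem IsIntervalModel.exists_pierced {V : Type*} {G : SimpleGraph V} {l r : V → ℝ}
    (A : Finset V) (h : IsIntervalModel G A l r) :
    ∃ (l' r' : V → ℝ) (C : Finset ℝ), IsIntervalModel G A l' r' ∧ IsPierced A l' r' C ∧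
      C.Nonempty ∧ C.card ≤ max 1 ((A.card - 1) / 2) := by
  classical
  induction A using Finset.strongInduction with
  | H A ih =>
  by_cases hstar : ∃ z ∈ A, ∀ v ∈ A, G.Adj z v → ∀ w ∈ A, G.Adj v w → w = z
  · -- the component of `z` in the subgraph is a star
    obtain ⟨z, hz, hleaf⟩ := hstar
    let A' := A.filter fun v => v ≠ z ∧ ¬ G.Adj z v
    let N := A.filter fun v => G.Adj z v
    have hA' : A' ⊂ A := by
      refine Finset.ssubset_iff_subset_ne.2 ⟨Finset.filter_subset _ _, fun e => ?_⟩
      rw [← e] at hz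
      simp [A'] at hz
    obtain ⟨l₁, r₁, C, h₁, hC, hne, hcard⟩ := ih A' hA' (h.mono hA'.subset)
    obtain ⟨l₂, r₂, h₂, hC₂, hf⟩ := h₁.exists_insert_isolated hC hne (z := z) (by simp [A'])
      (fun w hw => by simp only [A', Finset.mem_filter] at hw; exact hw.2.2)
    have hA : A = insert z A' ∪ N := by
      ext v
      have := G.ne_of_adj (a := z) (b := v)
      simp only [A', N, Finset.mem_union, Finset.mem_insert, Finset.mem_filter]
      grind
    obtain ⟨l₃, r₃, h₃, hC₃, -⟩ := h₂.exists_union_leaves_of_first hC₂ (z := z) (by simp)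
      (fun w hw hwz => hf w (by grind)) N
      (by
        rw [Finset.disjoint_left]
        intro v hv hv'
        have := G.ne_of_adj (a := z) (b := v)
        simp only [A', N, Finset.mem_insert, Finset.mem_filter] at hv hv'
        grind)
      (fun v hv w hw => by
        rw [← hA] at hw
        simp only [N, Finset.mem_filter] at hv
        exact ⟨hleaf v hv.1 hv.2 w hw, fun e => e ▸ hv.2.symm⟩)
    rw [← hA] at h₃ hC₃
    refine ⟨l₃, r₃, C, h₃, hC₃, hne, hcard.trans (max_le_max le_rfl ?_)⟩
    have := Finset.card_lt_card hA'
    omega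
  push Not at hstar
  -- the leaves, the other vertices, and those of the latter that have a leaf as a neighbour
  let L := A.filter fun v => (A.filter (G.Adj v)).card = 1
  let R := A.filter fun v => (A.filter (G.Adj v)).card ≠ 1
  let P := R.filter fun u => ∃ v ∈ L, G.Adj u v
  have hLA : L ⊆ A := Finset.filter_subset _ _
  have hRA : R ⊆ A := Finset.filter_subset _ _
  have hPR : P ⊆ R := Finset.filter_subset _ _
  have hA : A = R ∪ L := by
    ext v; simp only [R, L, Finset.mem_union, Finset.mem_filter]; tauto
  have hRL : Disjoint L R := by
    rw [Finset.disjoint_left]; intro v hv hv'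
    simp only [R, L, Finset.mem_filter] at hv hv'; tauto
  have hlow : ∀ z ∈ A, ∃ w ∈ R, G.Adj z w := by
    intro z hz
    obtain ⟨v, hv, hzv, w, hw, hvw, hwz⟩ := hstar z hz
    refine ⟨v, ?_, hzv⟩
    simp only [R, Finset.mem_filter, hv, true_and]
    intro e
    obtain ⟨t, ht⟩ := Finset.card_eq_one.1 e
    have e1 : z ∈ A.filter (G.Adj v) := by simp [hz, hzv.symm]
    have e2 : w ∈ A.filter (G.Adj v) := by simp [hw, hvw]
    rw [ht, Finset.mem_singleton] at e1 e2
    exact hwz (e2.trans e1.symm)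
  have hleaf : ∀ v ∈ L, ∃ u ∈ P, ∀ w ∈ A, G.Adj v w ↔ w = u := by
    intro v hv
    obtain ⟨u, hu, hvu⟩ := hlow v (hLA hv)
    refine ⟨u, by simp only [P, Finset.mem_filter]; exact ⟨hu, v, hv, hvu.symm⟩,
      fun w hw => ⟨fun hvw => ?_, fun e => e ▸ hvu⟩⟩
    simp only [L, Finset.mem_filter] at hv
    obtain ⟨t, ht⟩ := Finset.card_eq_one.1 hv.2
    have e1 : u ∈ A.filter (G.Adj v) := by simp [hRA hu, hvu]
    have e2 : w ∈ A.filter (G.Adj v) := by simp [hw, hvw]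
    rw [ht, Finset.mem_singleton] at e1 e2
    exact e2.trans e1.symm
  have hdeg : ∀ s ∈ R, s ∉ P → 2 ≤ (R.filter (G.Adj s)).card := by
    intro s hs hsP
    obtain ⟨w, hw, hsw⟩ := hlow s (hRA hs)
    have e : R.filter (G.Adj s) = A.filter (G.Adj s) := by
      ext v
      simp only [Finset.mem_filter]
      refine ⟨fun hv => ⟨hRA hv.1, hv.2⟩, fun hv => ⟨?_, hv.2⟩⟩
      by_contra hvR
      have hvL : v ∈ L := by
        rw [hA] at hv
        grind
      exact hsP (by simp only [P, Finset.mem_filter]; exact ⟨hs, v, hvL, hv.2⟩)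
    have h1 : 0 < (A.filter (G.Adj s)).card := Finset.card_pos.2 ⟨w, by simp [hRA hw, hsw]⟩
    simp only [R, Finset.mem_filter] at hs
    rw [e]; omega
  rcases P.eq_empty_or_nonempty with hP | ⟨z, hz⟩
  · have hR : R = A := by
      rw [hA]
      have : L = ∅ := by
        refine Finset.eq_empty_of_forall_notMem fun v hv => ?_
        obtain ⟨u, hu, -⟩ := hleaf v hv
        simp [hP] at hu
      simp [this]
    rw [hR] at hdeg
    exact h.exists_pierced_of_two_le_degree fun s hs => hdeg s hs (by simp [hP])
  have hzR := hPR hz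
  obtain ⟨l₁, r₁, C, a, b, h₁, hC, hcard, hfirst, hhat, hdisj⟩ :=
    (h.mono hRA).exists_pierced_with_hats hPR hdeg hz (by
      obtain ⟨w, hw, hzw⟩ := hlow z (hRA hzR)
      exact Finset.card_pos.2 ⟨w, by simp [hw, hzw]⟩)
  let N := L.filter fun v => ¬ G.Adj z v
  let N' := L.filter fun v => G.Adj z v
  have hNL : N ⊆ L := Finset.filter_subset _ _
  have hNL' : N' ⊆ L := Finset.filter_subset _ _
  have hA' : A = R ∪ N ∪ N' := by
    rw [hA]
    ext v
    simp only [N, N', Finset.mem_union, Finset.mem_filter]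
    tauto
  obtain ⟨l₂, r₂, h₂, hC₂, hag, hbd⟩ := h₁.exists_union_leaves_of_hats hC
    ((Finset.erase_subset _ _).trans hPR) hhat hdisj N (Finset.disjoint_of_subset_left hNL hRL)
    (fun v hv => by
      obtain ⟨u, hu, huv⟩ := hleaf v (hNL hv)
      refine ⟨u, Finset.mem_erase.2 ⟨?_, hu⟩, fun w hw => huv w (hA' ▸ Finset.mem_union_left _ hw)⟩
      rintro rfl
      have := (huv u (hRA hzR)).2 rfl
      simp only [N, Finset.mem_filter] at hv
      exact hv.2 this.symm)
  have hf₂ : ∀ w ∈ R ∪ N, w ≠ z → l₂ z < l₂ w := by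
    intro w hw hwz
    rw [(hag z hzR).1]
    rcases Finset.mem_union.1 hw with hw | hw
    · rw [(hag w hw).1]
      exact hfirst w hw hwz
    · obtain ⟨u, hu, hau⟩ := hbd w hw
      have hu' := Finset.mem_erase.1 hu
      obtain ⟨-, h1, h2⟩ := hhat u hu
      have h3 := (h2 z hzR hu'.1.symm).1
      have h4 := hfirst u (hPR hu'.2) hu'.1
      have h5 := h₁.lt u (hPR hu'.2)
      rcases h3 with h3 | h3
      · linarith
      · exfalso
        rcases h1 with h1 | h1 <;> linarith
  obtain ⟨l₃, r₃, h₃, hC₃, -⟩ := h₂.exists_union_leaves_of_first hC₂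
    (Finset.mem_union_left _ hzR) hf₂ N'
    (by
      rw [Finset.disjoint_union_right]
      refine ⟨Finset.disjoint_of_subset_left hNL' hRL, ?_⟩
      exact (Finset.disjoint_filter_filter_not L L _))
    (fun v hv w hw => by
      obtain ⟨u, hu, huv⟩ := hleaf v (hNL' hv)
      simp only [N', Finset.mem_filter] at hv
      have := (huv z (hRA hzR)).1 hv.2.symm
      rw [← hA'] at hw
      rw [huv w hw, this])
  rw [← hA'] at h₃ hC₃
  obtain ⟨c, hc, -⟩ := hC z hzR
  refine ⟨l₃, r₃, C, h₃, hC₃, ⟨c, hc⟩, le_max_of_le_right ?_⟩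
  have hPL : P.card ≤ L.card := by
    have hex : ∀ u ∈ P, ∃ v ∈ L, G.Adj u v := fun u hu => by
      simp only [P, Finset.mem_filter] at hu; exact hu.2
    choose! f hf using hex
    refine Finset.card_le_card_of_injOn f (fun u hu => (hf u hu).1) ?_
    intro u hu u' hu' e
    obtain ⟨t, -, ht⟩ := hleaf (f u) (hf u hu).1
    have e1 := (ht u (hRA (hPR hu))).1 (hf u hu).2.symm
    have e2 := (ht u' (hRA (hPR hu'))).1 (e ▸ (hf u' hu').2.symm)
    exact e1.trans e2.symm
  have : A.card = R.card + L.card := by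
    rw [hA]; exact Finset.card_union_of_disjoint hRL.symm
  omega

/-! ### From pierced interval models to polygon graphs -/

lemma exists_rank {V : Type*} [Fintype V] (f : V → ℝ) (hf : Function.Injective f) :
    ∃ e : V ≃ Fin (Fintype.card V), ∀ u v, e u < e v ↔ f u < f v := by
  let _ : LinearOrder V := LinearOrder.lift' f hf
  let e := Fintype.orderIsoFinOfCardEq V rfl
  exact ⟨e.symm.toEquiv, fun u v => e.symm.lt_iff_lt⟩

/-- Intervals with a common interior point: the left ends and the right ends give the two orders
of a permutation graph. -/
lemma IsIntervalModel.isPermutationGraph {V : Type*} [Fintype V] {G : SimpleGraph V}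
    {l r : V → ℝ} (h : IsIntervalModel G Finset.univ l r) {c : ℝ}
    (hc : IsPierced Finset.univ l r {c}) : IsPermutationGraph G := by
  have hl : Function.Injective l := fun u v e => by
    by_contra hne; exact h.left_ne u (by simp) v (by simp) hne e
  have hr : Function.Injective fun v => - r v := fun u v e => by
    by_contra hne; exact h.right_ne u (by simp) v (by simp) hne (by simpa using e)
  obtain ⟨e, he⟩ := exists_rank l hl
  obtain ⟨e', he'⟩ := exists_rank _ hr
  refine ⟨e, e'.symm.trans e, fun u v => ?_⟩
  have h1 : ∀ w, (e'.symm.trans e).symm (e w) = e' w := fun w => by simp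
  rw [h1, h1]
  have k1 := he u v
  have k2 := he v u
  have k3 := he' u v
  have k4 := he' v u
  rw [Fin.lt_def] at k1 k2 k3 k4
  have hcu := hc u (by simp)
  have hcv := hc v (by simp)
  simp only [Finset.mem_singleton, exists_eq_left] at hcu hcv
  by_cases huv : u = v
  · subst huv; simp
  rw [h.adj_iff u (by simp) v (by simp) huv, mul_neg_iff]
  unfold Overlap
  simp only [sub_pos, sub_neg, Nat.cast_lt, k1, k2, k3, k4, neg_lt_neg_iff]
  grind

section RegularPolygon
variable (k : ℕ)

/-- The corners of the regular polygon with `k` sides, with indices modulo `k`. -/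
noncomputable def regularCorner (j : ℕ) : ℂ :=
  Complex.exp ((2 * Real.pi * j / k : ℝ) * Complex.I)

/-- The boundary curve of the regular polygon: `t` runs through the side number `i` as `t` runs
through `[i, i + 1]`. -/
noncomputable def regularBoundary (t : ℝ) : ℂ :=
  (1 - (t - ⌊t⌋₊)) • regularCorner k ⌊t⌋₊ + (t - ⌊t⌋₊) • regularCorner k (⌊t⌋₊ + 1)

variable {k}

lemma regularCorner_orient_pos {i j m : ℕ} (h1 : i < j) (h2 : j < m) (h3 : m < i + k) :
    0 < planeOrient (regularCorner k i) (regularCorner k j) (regularCorner k m) := by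
  have hk : (0 : ℝ) < k := by
    have : 0 < k := by omega
    exact_mod_cast this
  have h1 : (i : ℝ) < j := by exact_mod_cast h1
  have h2 : (j : ℝ) < m := by exact_mod_cast h2
  have h3 : (m : ℝ) < i + k := by exact_mod_cast h3
  have hpi := Real.pi_pos
  refine planeOrient_exp_pos (by gcongr) (by gcongr) ?_
  rw [div_add' _ _ _ hk.ne']
  gcongr
  nlinarith

lemma regularCorner_orient_nonneg (hk : 0 < k) {i j m : ℕ} (h1 : i ≤ j) (h2 : j ≤ m)
    (h3 : m ≤ i + k) :
    0 ≤ planeOrient (regularCorner k i) (regularCorner k j) (regularCorner k m) := by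
  have hk : (0 : ℝ) < k := by exact_mod_cast hk
  have h1 : (i : ℝ) ≤ j := by exact_mod_cast h1
  have h2 : (j : ℝ) ≤ m := by exact_mod_cast h2
  have h3 : (m : ℝ) ≤ i + k := by exact_mod_cast h3
  have hpi := Real.pi_pos
  refine planeOrient_exp_nonneg (by gcongr) (by gcongr) ?_
  rw [div_add' _ _ _ hk.ne']
  gcongr
  nlinarith

lemma regularCorner_self (hk : 0 < k) : regularCorner k k = regularCorner k 0 := by
  have hk : (k : ℝ) ≠ 0 := by exact_mod_cast hk.ne'
  simp only [regularCorner]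
  rw [mul_div_assoc, div_self hk]
  simp

lemma regularCorner_finRotate (i : Fin k) :
    regularCorner k (finRotate k i : Fin k) = regularCorner k (i + 1) := by
  obtain _ | m := k
  · exact i.elim0
  rw [finRotate_apply, Fin.val_add_one]
  split_ifs with h
  · subst h
    simpa using (regularCorner_self (Nat.succ_pos m)).symm
  · rfl

lemma norm_regularCorner (j : ℕ) : ‖regularCorner k j‖ = 1 :=
  Complex.norm_exp_ofReal_mul_I _

lemma isConvexPolygon_regularCorner (hk : 3 ≤ k) :
    IsConvexPolygon k fun i : Fin k => regularCorner k i where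
  three_le := hk
  left_of_side i j h1 h2 := by
    rw [regularCorner_finRotate]
    have hi := i.2
    have hj := j.2
    have h1 : (j : ℕ) ≠ i := fun e => h1 (Fin.ext e)
    have h2 : (j : ℕ) ≠ if (i : ℕ) + 1 = k then 0 else (i : ℕ) + 1 := by
      intro e
      apply h2
      apply Fin.ext
      rw [e]
      obtain _ | m := k
      · omega
      rw [finRotate_apply, Fin.val_add_one]
      simp only [Fin.ext_iff, Fin.val_last, Nat.add_right_cancel_iff]
    rcases lt_or_gt_of_ne h1 with h | h
    · rw [← planeOrient_rotate]
      refine regularCorner_orient_pos h (by omega) ?_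
      split_ifs at h2 <;> omega
    · refine regularCorner_orient_pos (by omega) ?_ (by omega)
      split_ifs at h2 <;> omega

lemma regularCorner_succ_ne (hk : 3 ≤ k) (i : ℕ) :
    regularCorner k i ≠ regularCorner k (i + 1) := by
  intro e
  have := regularCorner_orient_pos (k := k) (i := i) (j := i + 1) (m := i + 2) (by omega)
    (by omega) (by omega)
  rw [e, planeOrient_rotate, planeOrient_left] at this
  exact this.false

/-- A point in the interior of a later side is strictly to the left of an earlier side. -/
lemma regularCorner_side_pos (hk : 3 ≤ k) {i j : ℕ} (hij : i < j) (hj : j < k) {s : ℝ}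
    (h0 : 0 < s) (h1 : s < 1) :
    0 < planeOrient (regularCorner k i) (regularCorner k (i + 1))
      ((1 - s) • regularCorner k j + s • regularCorner k (j + 1)) := by
  rw [planeOrient_combo _ _ _ _ _ _ (by ring)]
  have a1 := regularCorner_orient_nonneg (k := k) (by omega) (show i ≤ i + 1 by omega)
    (show i + 1 ≤ j by omega) (by omega)
  have a2 := regularCorner_orient_nonneg (k := k) (by omega) (show i ≤ i + 1 by omega)
    (show i + 1 ≤ j + 1 by omega) (by omega)
  rcases (show i + 1 = j ∨ i + 1 < j by omega) with h | h
  · have := regularCorner_orient_pos (k := k) (show i < i + 1 by omega)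
      (show i + 1 < j + 1 by omega) (by omega)
    nlinarith [mul_nonneg (sub_nonneg.2 h1.le) a1, mul_pos h0 this]
  · have := regularCorner_orient_pos (k := k) (show i < i + 1 by omega) h (by omega)
    nlinarith [mul_pos (sub_pos.2 h1) this, mul_nonneg h0.le a2]

/-- A point in the interior of an earlier side is strictly to the left of a later side. -/
lemma regularCorner_side_pos' (hk : 3 ≤ k) {i j : ℕ} (hij : i < j) (hj : j < k) {s : ℝ}
    (h0 : 0 < s) (h1 : s < 1) :
    0 < planeOrient (regularCorner k j) (regularCorner k (j + 1))
      ((1 - s) • regularCorner k i + s • regularCorner k (i + 1)) := by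
  rw [planeOrient_combo _ _ _ _ _ _ (by ring), ← planeOrient_rotate (regularCorner k i),
    ← planeOrient_rotate (regularCorner k (i + 1))]
  have a1 := regularCorner_orient_nonneg (k := k) (by omega) (show i ≤ j by omega)
    (show j ≤ j + 1 by omega) (by omega)
  have a2 := regularCorner_orient_nonneg (k := k) (by omega) (show i + 1 ≤ j by omega)
    (show j ≤ j + 1 by omega) (by omega)
  rcases (show i + 1 = j ∨ i + 1 < j by omega) with h | h
  · have := regularCorner_orient_pos (k := k) (show i < j by omega)
      (show j < j + 1 by omega) (by omega)
    nlinarith [mul_pos (sub_pos.2 h1) this, mul_nonneg h0.le a2]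
  · have := regularCorner_orient_pos (k := k) h (show j < j + 1 by omega) (by omega)
    nlinarith [mul_nonneg (sub_nonneg.2 h1.le) a1, mul_pos h0 this]

/-- Two points of one side and a third point. -/
lemma planeOrient_same_side (p q x : ℂ) (s t : ℝ) :
    planeOrient ((1 - s) • p + s • q) ((1 - t) • p + t • q) x =
      (t - s) * planeOrient p q x := by
  simp [planeOrient]; ring

lemma planeOrient_combo_combo_combo (p p' q q' r r' : ℂ) (s t u : ℝ) :
    planeOrient ((1 - s) • p + s • p') ((1 - t) • q + t • q') ((1 - u) • r + u • r') =
      (1 - s) * (1 - t) * (1 - u) * planeOrient p q r + s * (1 - t) * (1 - u) *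
        planeOrient p' q r + (1 - s) * t * (1 - u) * planeOrient p q' r +
      (1 - s) * (1 - t) * u * planeOrient p q r' + s * t * (1 - u) * planeOrient p' q' r +
      s * (1 - t) * u * planeOrient p' q r' + (1 - s) * t * u * planeOrient p q' r' +
      s * t * u * planeOrient p' q' r' := by
  simp [planeOrient]; ring

lemma floor_facts {x : ℝ} (hx : 0 ≤ x) (hn : ∀ n : ℕ, x ≠ n) :
    0 < x - ⌊x⌋₊ ∧ x - ⌊x⌋₊ < 1 := by
  have h1 := Nat.floor_le hx
  have h2 := Nat.lt_floor_add_one x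
  have h3 := hn ⌊x⌋₊
  exact ⟨sub_pos.2 (lt_of_le_of_ne h1 h3.symm), by linarith⟩

/-- The boundary of the regular polygon is a convex curve. -/
lemma regularBoundary_orient_pos (hk : 3 ≤ k) {x y z : ℝ} (hx0 : 0 ≤ x)
    (hxn : ∀ n : ℕ, x ≠ n) (hyn : ∀ n : ℕ, y ≠ n) (hzn : ∀ n : ℕ, z ≠ n)
    (hxy : x < y) (hyz : y < z) (hzk : z < k) (hxz : ⌊x⌋₊ < ⌊z⌋₊) :
    0 < planeOrient (regularBoundary k x) (regularBoundary k y) (regularBoundary k z) := by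
  have hy0 : 0 ≤ y := by linarith
  have hz0 : 0 ≤ z := by linarith
  obtain ⟨x1, x2⟩ := floor_facts hx0 hxn
  obtain ⟨y1, y2⟩ := floor_facts hy0 hyn
  obtain ⟨z1, z2⟩ := floor_facts hz0 hzn
  have hm : ⌊z⌋₊ < k := (Nat.floor_lt hz0).2 hzk
  have hij : ⌊x⌋₊ ≤ ⌊y⌋₊ := Nat.floor_mono hxy.le
  have hjm : ⌊y⌋₊ ≤ ⌊z⌋₊ := Nat.floor_mono hyz.le
  have hst : ⌊x⌋₊ = ⌊y⌋₊ → x - ⌊x⌋₊ < y - ⌊y⌋₊ := fun e => by rw [e]; linarith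
  have htu : ⌊y⌋₊ = ⌊z⌋₊ → y - ⌊y⌋₊ < z - ⌊z⌋₊ := fun e => by rw [e]; linarith
  unfold regularBoundary
  generalize x - (⌊x⌋₊ : ℝ) = s at *
  generalize y - (⌊y⌋₊ : ℝ) = t at *
  generalize z - (⌊z⌋₊ : ℝ) = u at *
  generalize ⌊x⌋₊ = i at *
  generalize ⌊y⌋₊ = j at *
  generalize ⌊z⌋₊ = m at *
  clear hxn hyn hzn hxy hyz hzk hx0 hy0 hz0
  rcases hij.eq_or_lt with rfl | hij
  · rw [planeOrient_same_side]
    exact mul_pos (sub_pos.2 (hst rfl)) (regularCorner_side_pos hk hxz hm z1 z2)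
  rcases hjm.eq_or_lt with rfl | hjm
  · rw [planeOrient_rotate, planeOrient_same_side]
    exact mul_pos (sub_pos.2 (htu rfl)) (regularCorner_side_pos' hk hxz hm x1 x2)
  have hk0 : 0 < k := by omega
  rw [planeOrient_combo_combo_combo]
  have key : ∀ a b c : ℕ, i ≤ a → a ≤ i + 1 → j ≤ b → b ≤ j + 1 → m ≤ c → c ≤ m + 1 →
      0 ≤ planeOrient (regularCorner k a) (regularCorner k b) (regularCorner k c) :=
    fun a b c _ _ _ _ _ _ => regularCorner_orient_nonneg hk0 (by omega) (by omega) (by omega)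
  have h0 := regularCorner_orient_pos (k := k) hij hjm (by omega)
  have h1 := key (i + 1) j m (by omega) (by omega) (by omega) (by omega) (by omega) (by omega)
  have h2 := key i (j + 1) m (by omega) (by omega) (by omega) (by omega) (by omega) (by omega)
  have h3 := key i j (m + 1) (by omega) (by omega) (by omega) (by omega) (by omega) (by omega)
  have h4 := key (i + 1) (j + 1) m (by omega) (by omega) (by omega) (by omega) (by omega)
    (by omega)
  have h5 := key (i + 1) j (m + 1) (by omega) (by omega) (by omega) (by omega) (by omega)
    (by omega)
  have h6 := key i (j + 1) (m + 1) (by omega) (by omega) (by omega) (by omega) (by omega)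
    (by omega)
  have h7 := key (i + 1) (j + 1) (m + 1) (by omega) (by omega) (by omega) (by omega) (by omega)
    (by omega)
  have hs := sub_pos.2 x2
  have ht := sub_pos.2 y2
  have hu := sub_pos.2 z2
  positivity

lemma regularBoundary_mem_side {x : ℝ} (hx : 0 ≤ x) (hxk : x < k) :
    regularBoundary k x ∈ polygonSide (fun i : Fin k => regularCorner k i)
      ⟨⌊x⌋₊, (Nat.floor_lt hx).2 hxk⟩ := by
  rw [polygonSide, regularCorner_finRotate]
  exact ⟨_, _, by linarith [Nat.lt_floor_add_one x], by linarith [Nat.floor_le hx], by ring, rfl⟩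

lemma regularBoundary_ne_corner (hk : 3 ≤ k) {x : ℝ} (hx : 0 ≤ x) (hn : ∀ n : ℕ, x ≠ n) (j : ℕ) :
    regularBoundary k x ≠ regularCorner k j := by
  obtain ⟨h1, h2⟩ := floor_facts hx hn
  intro e
  have := norm_combo_lt_of_ne (norm_regularCorner (k := k) ⌊x⌋₊).le
    (norm_regularCorner (k := k) (⌊x⌋₊ + 1)).le (regularCorner_succ_ne hk _) (sub_pos.2 h2) h1
    (by ring)
  have h3 : regularBoundary k x = (1 - (x - ⌊x⌋₊)) • regularCorner k ⌊x⌋₊ +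
    (x - ⌊x⌋₊) • regularCorner k (⌊x⌋₊ + 1) := rfl
  rw [← h3, e, norm_regularCorner] at this
  exact this.false

lemma regularBoundary_ne_of_lt (hk : 3 ≤ k) {x y : ℝ} (hx : 0 ≤ x) (hyn : ∀ n : ℕ, y ≠ n)
    (hxy : x < y) (hyk : y < k) : regularBoundary k x ≠ regularBoundary k y := by
  have hy0 : 0 ≤ y := by linarith
  have hj : ⌊y⌋₊ < k := (Nat.floor_lt hy0).2 hyk
  obtain ⟨y1, y2⟩ := floor_facts hy0 hyn
  intro e
  rcases (Nat.floor_mono hxy.le : ⌊x⌋₊ ≤ ⌊y⌋₊).eq_or_lt with h | h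
  · have h1 := planeOrient_same_side (regularCorner k ⌊x⌋₊) (regularCorner k (⌊x⌋₊ + 1))
      (regularCorner k (⌊x⌋₊ + 2)) (x - ⌊x⌋₊) (y - ⌊x⌋₊)
    have h2 := regularCorner_orient_pos (k := k) (i := ⌊x⌋₊) (j := ⌊x⌋₊ + 1) (m := ⌊x⌋₊ + 2)
      (by omega) (by omega) (by omega)
    unfold regularBoundary at e
    rw [← h] at e
    rw [e, planeOrient_rotate, planeOrient_rotate, planeOrient_right] at h1
    have : 0 < (y - ⌊x⌋₊ - (x - ⌊x⌋₊)) := by linarith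
    exact (mul_pos this h2).ne h1
  · have h1 := regularCorner_side_pos hk h hj y1 y2
    have h2 : planeOrient (regularCorner k ⌊x⌋₊) (regularCorner k (⌊x⌋₊ + 1))
        (regularBoundary k x) = 0 := by
      unfold regularBoundary
      rw [planeOrient_combo _ _ _ _ _ _ (by ring), planeOrient_left, planeOrient_right]
      ring
    rw [e] at h2
    exact h1.ne' h2

end RegularPolygon

/-- Intervals pierced by `k - 1` points, drawn in a polygon with `k` sides: the points, and the
point at infinity, become the corners. -/
lemma IsIntervalModel.hasPolygonRepresentation {V : Type*} [Fintype V] {G : SimpleGraph V}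
    {l r : V → ℝ} (h : IsIntervalModel G Finset.univ l r) {C : Finset ℝ}
    (hC : IsPierced Finset.univ l r C) (hcard : 2 ≤ C.card) :
    HasPolygonRepresentation (C.card + 1) G := by
  have hk : 3 ≤ C.card + 1 := by omega
  -- the position on the boundary: the number of the side, plus a position inside that side
  let σ : ℝ → ℝ := fun x => 1 / 2 + Real.arctan x / Real.pi
  have hpi := Real.pi_pos
  have hσ0 : ∀ x, 0 < σ x := fun x => by
    have := (div_lt_div_iff_of_pos_right hpi).2 (Real.neg_pi_div_two_lt_arctan x)
    rw [show -(Real.pi / 2) / Real.pi = -(1 / 2) by field_simp] at this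
    simp only [σ]; linarith
  have hσ1 : ∀ x, σ x < 1 := fun x => by
    have := (div_lt_div_iff_of_pos_right hpi).2 (Real.arctan_lt_pi_div_two x)
    rw [show Real.pi / 2 / Real.pi = 1 / 2 by field_simp] at this
    simp only [σ]; linarith
  have hσ : ∀ x y, x < y → σ x < σ y := fun x y hxy => by
    have := (div_lt_div_iff_of_pos_right hpi).2 (Real.arctan_strictMono hxy)
    simp only [σ]; linarith
  clear_value σ
  let m : ℝ → ℕ := fun x => (C.filter (· < x)).card
  have hm : ∀ x y, x ≤ y → m x ≤ m y := fun x y hxy =>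
    Finset.card_le_card fun c hc => by
      simp only [Finset.mem_filter] at hc ⊢
      exact ⟨hc.1, hc.2.trans_le hxy⟩
  have hmC : ∀ x, m x ≤ C.card := fun x => Finset.card_filter_le _ _
  have hmlt : ∀ v, m (l v) < m (r v) := fun v => by
    obtain ⟨c, hc, h1, h2⟩ := hC v (by simp)
    refine Finset.card_lt_card (Finset.ssubset_iff_of_subset ?_ |>.2 ⟨c, ?_, ?_⟩)
    · intro e he
      simp only [Finset.mem_filter] at he ⊢
      exact ⟨he.1, he.2.trans (h1.trans h2)⟩
    · simp [hc, h2]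
    · simp [h1.le]
  clear_value m
  let f : ℝ → ℝ := fun x => m x + σ x
  have hfl : ∀ x, ⌊f x⌋₊ = m x := fun x => by
    rw [Nat.floor_eq_iff (by have := hσ0 x; simp only [f]; positivity)]
    simp only [f]
    constructor <;> linarith [hσ0 x, hσ1 x]
  have hf0 : ∀ x, 0 ≤ f x := fun x => by have := hσ0 x; simp only [f]; positivity
  have hfk : ∀ x, f x < (C.card + 1 : ℕ) := fun x => by
    have : (m x : ℝ) ≤ C.card := by exact_mod_cast hmC x
    push_cast
    simp only [f]
    linarith [hσ1 x]
  have hfn : ∀ x (n : ℕ), f x ≠ n := fun x n e => by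
    have h1 := hfl x
    rw [e, Nat.floor_natCast] at h1
    rw [h1] at e
    simp only [f] at e
    linarith [hσ0 x]
  have hf : ∀ x y, x < y → f x < f y := fun x y hxy => by
    have : (m x : ℝ) ≤ m y := by exact_mod_cast hm x y hxy.le
    simp only [f]
    linarith [hσ x y hxy]
  clear_value f
  let γ : ℝ → ℂ := fun x => regularBoundary (C.card + 1) (f x)
  have hγ : ∀ x y z, x < y → y < z → m x < m z → 0 < planeOrient (γ x) (γ y) (γ z) :=
    fun x y z hxy hyz hxz => regularBoundary_orient_pos hk (hf0 x) (hfn x) (hfn y) (hfn z)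
      (hf x y hxy) (hf y z hyz) (hfk z) (by rw [hfl, hfl]; exact hxz)
  refine ⟨_, isConvexPolygon_regularCorner hk, γ ∘ l, γ ∘ r, fun v => ?_, fun v => ?_,
    h.isChordModel γ ?_ ?_⟩
  · refine ⟨_, _, ?_, regularBoundary_mem_side (hf0 (l v)) (hfk (l v)),
      regularBoundary_mem_side (hf0 (r v)) (hfk (r v))⟩
    simp only [hfl]
    intro e
    exact (hmlt v).ne (Fin.mk.inj_iff.1 e)
  · constructor
    · rintro ⟨i, hi⟩
      exact regularBoundary_ne_corner hk (hf0 _) (hfn _) i hi.symm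
    · rintro ⟨i, hi⟩
      exact regularBoundary_ne_corner hk (hf0 _) (hfn _) i hi.symm
  · have key : ∀ x y, x < y → γ x ≠ γ y := fun x y hxy =>
      regularBoundary_ne_of_lt hk (hf0 x) (hfn y) (hf x y hxy) (hfk y)
    intro x _ y _ hxy
    by_contra hne
    rcases lt_or_gt_of_ne hne with h1 | h1
    · exact key x y h1 hxy
    · exact key y x h1 hxy.symm
  · intro u x _
    have hlt := h.lt u (by simp)
    have := hmlt u
    exact chord_sides γ
      (fun h1 => hγ _ _ _ h1 hlt ((hm _ _ h1.le).trans_lt (hmlt u)))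
      (fun h1 h2 => hγ _ _ _ h1 h2 (hmlt u))
      (fun h1 => hγ _ _ _ hlt h1 ((hmlt u).trans_le (hm _ _ h1.le)))

lemma ceil_half (n : ℕ) : ⌈(n : ℚ) / 2⌉₊ = (n + 1) / 2 := by
  apply le_antisymm
  · rw [Nat.ceil_le, div_le_iff₀ (by norm_num)]
    have : n ≤ (n + 1) / 2 * 2 := by omega
    exact_mod_cast this
  · have h1 : (n : ℚ) ≤ ⌈(n : ℚ) / 2⌉₊ * 2 := by
      rw [← div_le_iff₀ (by norm_num)]
      exact Nat.le_ceil _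
    have h2 : n ≤ ⌈(n : ℚ) / 2⌉₊ * 2 := by exact_mod_cast h1
    omega

/-- The upper bound on the polygon number of a circle graph. -/
theorem IsCircleGraph.polygonNumber_le {V : Type*} [Fintype V] {G : SimpleGraph V}
    (hG : IsCircleGraph G) (hV : 3 ≤ Fintype.card V) :
    polygonNumber G ≤ ((Fintype.card V + 1) / 2 : ℕ) := by
  obtain ⟨l₀, r₀, h₀⟩ := hG.exists_intervalModel
  obtain ⟨l, r, C, h, hC, hne, hcard⟩ := h₀.exists_pierced
  rw [Finset.card_univ] at hcard
  have hC1 := hne.card_pos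
  have hle : C.card + 1 ≤ (Fintype.card V + 1) / 2 := by omega
  refine (iInf₂_le (C.card + 1) ?_).trans (by exact_mod_cast hle)
  by_cases h1 : C.card = 1
  · obtain ⟨c, rfl⟩ := Finset.card_eq_one.1 h1
    exact .inl ⟨by simp, h.isPermutationGraph hC⟩
  · exact .inr ⟨by omega, h.hasPolygonRepresentation hC (by omega)⟩

/-! ### Cycles -/

lemma cycleGraph_adj_iff {n : ℕ} (hn : 3 ≤ n) (u v : Fin n) :
    (SimpleGraph.cycleGraph n).Adj u v ↔ (u : ℕ) + 1 = v ∨ (v : ℕ) + 1 = u ∨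
      ((u : ℕ) = 0 ∧ (v : ℕ) + 1 = n) ∨ ((v : ℕ) = 0 ∧ (u : ℕ) + 1 = n) := by
  rw [SimpleGraph.cycleGraph_adj', Fin.val_sub, Fin.val_sub]
  have hu := u.2
  have hv := v.2
  have key : ∀ a b : ℕ, a < n → b < n →
      ((n - b + a) % n = 1 ↔ b + 1 = a ∨ (a = 0 ∧ b + 1 = n)) := by
    intro a b ha hb
    rcases lt_or_ge (n - b + a) n with h | h
    · rw [Nat.mod_eq_of_lt h]; omega
    · rw [Nat.mod_eq_sub_mod h, Nat.mod_eq_of_lt (by omega)]; omega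
  rw [key _ _ hu hv, key _ _ hv hu]
  omega

/-- Around the cycle, each chord meets exactly the next one. -/
lemma isCircleGraph_cycleGraph {n : ℕ} (hn : 3 ≤ n) :
    IsCircleGraph (SimpleGraph.cycleGraph n) := by
  let L : Fin n → ℕ := fun i => if (i : ℕ) + 1 < n then 2 * i else 1
  let R : Fin n → ℕ := fun i => if (i : ℕ) + 1 < n then 2 * i + 3 else 2 * n - 2
  have hLR : ∀ i : Fin n, ((i : ℕ) + 1 < n ∧ L i = 2 * i ∧ R i = 2 * i + 3) ∨
      ((i : ℕ) + 1 = n ∧ L i = 1 ∧ R i = 2 * n - 2) := by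
    intro i
    have := i.2
    by_cases h : (i : ℕ) + 1 < n
    · exact .inl ⟨h, by simp [L, h], by simp [R, h]⟩
    · exact .inr ⟨by omega, by simp [L, h], by simp [R, h]⟩
  clear_value L R
  have hn' : (0 : ℝ) < n := by
    have : 0 < n := by omega
    exact_mod_cast this
  have hd : 0 < Real.pi / n := div_pos Real.pi_pos hn'
  have hlt : ∀ a b : ℕ, (a : ℝ) * (Real.pi / n) < b * (Real.pi / n) ↔ a < b := fun a b => by
    rw [mul_lt_mul_iff_left₀ hd, Nat.cast_lt]
  have hne : ∀ a b : ℕ, a ≠ b → (a : ℝ) * (Real.pi / n) ≠ b * (Real.pi / n) := fun a b h e =>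
    h (by exact_mod_cast mul_right_cancel₀ hd.ne' e)
  have hpos : ∀ a : ℕ, a < 2 * n →
      0 ≤ (a : ℝ) * (Real.pi / n) ∧ (a : ℝ) * (Real.pi / n) < 2 * Real.pi := fun a ha => by
    refine ⟨by positivity, ?_⟩
    have := (hlt a (2 * n)).2 ha
    push_cast at this
    rwa [mul_assoc, mul_div_cancel₀ _ hn'.ne'] at this
  refine IsIntervalModel.isCircleGraph (l := fun i => L i * (Real.pi / n))
    (r := fun i => R i * (Real.pi / n)) ⟨?_, ?_, ?_, ?_, ?_⟩ (fun v => hpos _ ?_)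
    (fun v => hpos _ ?_)
  · intro u _
    have := hLR u
    exact (hlt _ _).2 (by omega)
  · intro u _ v _ huv
    have := hLR u
    have := hLR v
    have := Fin.val_ne_of_ne huv
    exact hne _ _ (by omega)
  · intro u _ v _ huv
    have := hLR u
    have := hLR v
    have := Fin.val_ne_of_ne huv
    exact hne _ _ (by omega)
  · intro u _ v _
    have := hLR u
    have := hLR v
    exact hne _ _ (by omega)
  · intro u _ v _ huv
    rw [cycleGraph_adj_iff hn]
    simp only [Overlap, hlt]
    have := hLR u
    have := hLR v
    have := Fin.val_ne_of_ne huv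
    omega
  · have := hLR v; omega
  · have := hLR v; omega

/-- The vertices of a cycle that are not neighbours of `i` induce a path. -/
lemma cycleGraph_nonneighbors_connected {n : ℕ} (hn : 3 ≤ n) (i : Fin n) (p : Fin n → Prop)
    (hp : ∀ j j', (SimpleGraph.cycleGraph n).Adj j j' → j ≠ i → j' ≠ i →
      ¬ (SimpleGraph.cycleGraph n).Adj i j → ¬ (SimpleGraph.cycleGraph n).Adj i j' → (p j → p j'))
    {j j' : Fin n} (hj : j ≠ i) (hj' : j' ≠ i) (hij : ¬ (SimpleGraph.cycleGraph n).Adj i j)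
    (hij' : ¬ (SimpleGraph.cycleGraph n).Adj i j') (h : p j) : p j' := by
  obtain ⟨m, rfl⟩ : ∃ m, n = m + 1 := ⟨n - 1, by omega⟩
  have hadj : ∀ x y : Fin (m + 1), (SimpleGraph.cycleGraph (m + 1)).Adj (i + x) (i + y) ↔
      (SimpleGraph.cycleGraph (m + 1)).Adj x y := by
    intro x y
    rw [SimpleGraph.cycleGraph_adj', SimpleGraph.cycleGraph_adj', add_sub_add_left_eq_sub,
      add_sub_add_left_eq_sub]
  have hadj0 : ∀ x : Fin (m + 1), (SimpleGraph.cycleGraph (m + 1)).Adj i (i + x) ↔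
      (SimpleGraph.cycleGraph (m + 1)).Adj 0 x := by
    intro x
    simpa using hadj 0 x
  have hnon : ∀ x : Fin (m + 1), (i + x ≠ i ∧ ¬ (SimpleGraph.cycleGraph (m + 1)).Adj i (i + x)) ↔
      2 ≤ (x : ℕ) ∧ (x : ℕ) < m := by
    intro x
    have hx := x.2
    rw [hadj0, cycleGraph_adj_iff hn, Ne, add_eq_left, Fin.ext_iff, Fin.val_zero]
    omega
  have hstep : ∀ x y : Fin (m + 1), 2 ≤ (x : ℕ) → (x : ℕ) + 1 = y → (y : ℕ) < m →
      (p (i + x) ↔ p (i + y)) := by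
    intro x y hx hxy hy
    obtain ⟨h1, h2⟩ := (hnon x).2 ⟨hx, by omega⟩
    obtain ⟨h3, h4⟩ := (hnon y).2 ⟨by omega, hy⟩
    have h5 : (SimpleGraph.cycleGraph (m + 1)).Adj (i + x) (i + y) := by
      rw [hadj, cycleGraph_adj_iff hn]
      omega
    exact ⟨hp _ _ h5 h1 h3 h2 h4, hp _ _ h5.symm h3 h1 h4 h2⟩
  have hall : ∀ (t : ℕ) (x y : Fin (m + 1)), (x : ℕ) = 2 → (y : ℕ) = 2 + t → (y : ℕ) < m →
      (p (i + x) ↔ p (i + y)) := by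
    intro t
    induction t with
    | zero =>
      intro x y hx hy _
      rw [show x = y from Fin.ext (by omega)]
    | succ t ih =>
      intro x y hx hy hym
      exact (ih x ⟨2 + t, by omega⟩ hx rfl (by simp only; omega)).trans
        (hstep _ _ (by simp) (by simp only; omega) hym)
  have hsub : ∀ k, i + (k - i) = k := fun k => by abel
  rw [← hsub j'] at hj' hij' ⊢
  rw [← hsub j] at hj hij h
  obtain ⟨h1, h2⟩ := (hnon _).1 ⟨hj, hij⟩
  obtain ⟨h3, h4⟩ := (hnon _).1 ⟨hj', hij'⟩
  have e1 := hall ((j - i : Fin (m + 1)) - 2 : ℕ) ⟨2, by omega⟩ (j - i) rfl (by omega) h2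
  have e2 := hall ((j' - i : Fin (m + 1)) - 2 : ℕ) ⟨2, by omega⟩ (j' - i) rfl (by omega) h4
  exact e2.1 (e1.2 h)

lemma not_isPermutationGraph_cycleGraph {n : ℕ} (hn : 5 ≤ n) :
    ¬ IsPermutationGraph (SimpleGraph.cycleGraph n) := by
  rintro ⟨e, π, h⟩
  have hx : ∀ u v, u ≠ v → ((e u : ℕ) : ℤ) ≠ (e v : ℕ) := fun u v huv he =>
    huv (e.injective (Fin.ext (by exact_mod_cast he)))
  have hy : ∀ u v, u ≠ v → ((π.symm (e u) : ℕ) : ℤ) ≠ (π.symm (e v) : ℕ) := fun u v huv he =>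
    huv (e.injective (π.symm.injective (Fin.ext (by exact_mod_cast he))))
  generalize hxd : (fun v => ((e v : ℕ) : ℤ)) = x at *
  generalize hyd : (fun v => ((π.symm (e v) : ℕ) : ℤ)) = y at *
  have hxd' : ∀ v, ((e v : ℕ) : ℤ) = x v := fun v => by rw [← hxd]
  have hyd' : ∀ v, ((π.symm (e v) : ℕ) : ℤ) = y v := fun v => by rw [← hyd]
  simp only [hxd', hyd'] at h hx hy
  clear hxd hyd hxd' hyd'
  -- all the vertices not adjacent to `i` come after it, or all come before it
  have hside : ∀ i j j' : Fin n, j ≠ i → j' ≠ i → ¬ (SimpleGraph.cycleGraph n).Adj i j →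
      ¬ (SimpleGraph.cycleGraph n).Adj i j' → x i < x j → x i < x j' := by
    intro i j j' hj hj' hij hij' hlt
    refine cycleGraph_nonneighbors_connected (by omega) i (fun j => x i < x j) ?_ hj hj' hij hij' hlt
    intro j j' hjj' hj hj' hij hij' hlt
    by_contra hlt'
    rw [h, mul_neg_iff] at hjj' hij hij'
    have h1 := hx j' i hj'
    have h2 := hy j' i hj'
    have h3 := hy j i hj
    omega
  let v : Fin 5 → Fin n := fun t => ⟨t, by omega⟩
  have hv : ∀ s t : Fin 5, (s : ℕ) + 2 ≤ t → (t : ℕ) - s ≤ 3 →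
      v t ≠ v s ∧ ¬ (SimpleGraph.cycleGraph n).Adj (v s) (v t) := by
    intro s t h1 h2
    rw [cycleGraph_adj_iff (by omega), Ne, Fin.ext_iff]
    simp only [v]
    omega
  have h02 := hv 0 2 (by simp) (by simp)
  have h03 := hv 0 3 (by simp) (by simp)
  have h13 := hv 1 3 (by simp) (by simp)
  have h14 := hv 1 4 (by simp) (by simp)
  have h24 := hv 2 4 (by simp) (by simp)
  have k : ∀ i j j' : Fin n, (j ≠ i ∧ ¬ (SimpleGraph.cycleGraph n).Adj i j) →
      (j' ≠ i ∧ ¬ (SimpleGraph.cycleGraph n).Adj i j') → (x i < x j ↔ x i < x j') :=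
    fun i j j' h1 h2 => ⟨hside i j j' h1.1 h2.1 h1.2 h2.2, hside i j' j h2.1 h1.1 h2.2 h1.2⟩
  have sw : ∀ i j : Fin n, (j ≠ i ∧ ¬ (SimpleGraph.cycleGraph n).Adj i j) →
      (i ≠ j ∧ ¬ (SimpleGraph.cycleGraph n).Adj j i) := fun i j h =>
    ⟨h.1.symm, fun h' => h.2 h'.symm⟩
  have k0 := k (v 0) (v 2) (v 3) h02 h03
  have k1 := k (v 1) (v 3) (v 4) h13 h14
  have k2 := k (v 2) (v 0) (v 4) (sw _ _ h02) h24
  have k3 := k (v 3) (v 0) (v 1) (sw _ _ h03) (sw _ _ h13)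
  have k4 := k (v 4) (v 1) (v 2) (sw _ _ h14) (sw _ _ h24)
  have n02 := hx _ _ h02.1
  have n03 := hx _ _ h03.1
  have n13 := hx _ _ h13.1
  have n14 := hx _ _ h14.1
  have n24 := hx _ _ h24.1
  omega

/-! ### Chords of convex polygons -/

section Polygon
variable {k : ℕ} {τ : Fin k → ℂ}

/-- The convex polygon with corners `τ`, as the intersection of the half-planes of its sides. -/
def polygonRegion (τ : Fin k → ℂ) : Set ℂ :=
  {x | ∀ i, 0 ≤ planeOrient (τ i) (τ (finRotate k i)) x}

lemma segment_subset_polygonRegion {x y : ℂ} (hx : x ∈ polygonRegion τ)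
    (hy : y ∈ polygonRegion τ) : segment ℝ x y ⊆ polygonRegion τ := by
  rintro _ ⟨s, t, hs, ht, hst, rfl⟩ i
  rw [planeOrient_combo _ _ _ _ _ _ hst]
  exact add_nonneg (mul_nonneg hs (hx i)) (mul_nonneg ht (hy i))

lemma finRotate_val (i : Fin k) :
    ((finRotate k i : Fin k) : ℕ) = if (i : ℕ) + 1 = k then 0 else (i : ℕ) + 1 := by
  obtain _ | m := k
  · exact i.elim0
  rw [finRotate_apply, Fin.val_add_one]
  simp only [Fin.ext_iff, Fin.val_last, Nat.add_right_cancel_iff]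

lemma IsConvexPolygon.corner_mem (hτ : IsConvexPolygon k τ) (j : Fin k) :
    τ j ∈ polygonRegion τ := by
  intro i
  by_cases h1 : j = i
  · rw [h1, planeOrient_left]
  by_cases h2 : j = finRotate k i
  · rw [h2, planeOrient_right]
  · exact (hτ.left_of_side i j h1 h2).le

lemma IsConvexPolygon.side_subset (hτ : IsConvexPolygon k τ) (i : Fin k) :
    polygonSide τ i ⊆ polygonRegion τ :=
  segment_subset_polygonRegion (hτ.corner_mem i) (hτ.corner_mem _)

lemma exists_combo_of_mem_side {i : Fin k} {x : ℂ} (hx : x ∈ polygonSide τ i)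
    (hx' : x ∉ Set.range τ) :
    ∃ s t : ℝ, 0 < s ∧ 0 < t ∧ s + t = 1 ∧ s • τ i + t • τ (finRotate k i) = x := by
  obtain ⟨s, t, hs, ht, hst, rfl⟩ := hx
  refine ⟨s, t, lt_of_le_of_ne hs ?_, lt_of_le_of_ne ht ?_, hst, rfl⟩
  · rintro rfl
    obtain rfl : t = 1 := by linarith
    exact hx' ⟨finRotate k i, by simp⟩
  · rintro rfl
    obtain rfl : s = 1 := by linarith
    exact hx' ⟨i, by simp⟩

/-- Of two different sides, one has an end that does not lie on the other. -/
lemma IsConvexPolygon.exists_end (hτ : IsConvexPolygon k τ) {i j : Fin k} (hij : i ≠ j) :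
    (i ≠ j ∧ i ≠ finRotate k j) ∨ (finRotate k i ≠ j ∧ finRotate k i ≠ finRotate k j) := by
  by_cases h : i = finRotate k j
  · refine .inr ⟨fun h' => ?_, fun h' => hij ((finRotate k).injective h')⟩
    have h1 := finRotate_val j
    have h2 := finRotate_val i
    rw [← h] at h1
    rw [h'] at h2
    have := hτ.three_le
    have := i.2
    have := j.2
    split_ifs at h1 h2 <;> omega
  · exact .inl ⟨hij, h⟩

lemma IsConvexPolygon.orient_pos_of_mem_side (hτ : IsConvexPolygon k τ) {i j : Fin k}
    (hij : i ≠ j) {x : ℂ} (hx : x ∈ polygonSide τ i) (hx' : x ∉ Set.range τ) :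
    0 < planeOrient (τ j) (τ (finRotate k j)) x := by
  obtain ⟨s, t, hs, ht, hst, rfl⟩ := exists_combo_of_mem_side hx hx'
  rw [planeOrient_combo _ _ _ _ _ _ hst]
  have h1 := hτ.corner_mem i j
  have h2 := hτ.corner_mem (finRotate k i) j
  rcases hτ.exists_end hij with h | h
  · exact add_pos_of_pos_of_nonneg (mul_pos hs (hτ.left_of_side j _ h.1 h.2)) (mul_nonneg ht.le h2)
  · exact add_pos_of_nonneg_of_pos (mul_nonneg hs.le h1) (mul_pos ht (hτ.left_of_side j _ h.1 h.2))

lemma orient_eq_zero_of_mem_side {i : Fin k} {x : ℂ} (hx : x ∈ polygonSide τ i) :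
    planeOrient (τ i) (τ (finRotate k i)) x = 0 := by
  obtain ⟨s, t, hs, ht, hst, rfl⟩ := hx
  rw [planeOrient_combo _ _ _ _ _ _ hst, planeOrient_left, planeOrient_right]
  ring

/-- A point of the line through `p` and `q`. -/
lemma exists_combo_of_orient_eq_zero {p q x : ℂ} (hpq : p ≠ q) (h : planeOrient p q x = 0) :
    ∃ s : ℝ, x = (1 - s) • p + s • q := by
  suffices H : ∃ s : ℝ, x.re = (1 - s) * p.re + s * q.re ∧ x.im = (1 - s) * p.im + s * q.im by
    obtain ⟨s, h1, h2⟩ := H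
    refine ⟨s, Complex.ext ?_ ?_⟩
    · simpa only [Complex.add_re, Complex.real_smul, Complex.re_ofReal_mul]
    · simpa only [Complex.add_im, Complex.real_smul, Complex.im_ofReal_mul]
  simp only [planeOrient] at h
  by_cases hre : p.re = q.re
  · have him : q.im - p.im ≠ 0 := fun e => hpq (Complex.ext hre (by linarith))
    have hx : x.re = p.re := by
      rw [hre, sub_self, zero_mul, zero_sub, neg_eq_zero, mul_eq_zero] at h
      rcases h with h | h
      · exact (him h).elim
      · linarith
    refine ⟨(x.im - p.im) / (q.im - p.im), ?_, ?_⟩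
    · rw [hx, ← hre]; ring
    · field_simp
      ring
  · have hre' : q.re - p.re ≠ 0 := fun e => hre (by linarith)
    refine ⟨(x.re - p.re) / (q.re - p.re), ?_, ?_⟩
    · field_simp
      ring
    · field_simp
      linarith

/-- `[p, q]` is a chord of the polygon with corners `τ`: its endpoints lie on two different sides
and are no corners. -/
def IsPolygonChord (τ : Fin k → ℂ) (p q : ℂ) : Prop :=
  ∃ i j : Fin k, i ≠ j ∧ (p ∈ polygonSide τ i ∧ q ∈ polygonSide τ j) ∧
    p ∉ Set.range τ ∧ q ∉ Set.range τ

lemma IsPolygonChord.symm {p q : ℂ} (h : IsPolygonChord τ p q) : IsPolygonChord τ q p :=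
  let ⟨i, j, hij, h1, h2⟩ := h
  ⟨j, i, hij.symm, h1.symm, h2.symm⟩

lemma IsPolygonChord.segment_subset (hτ : IsConvexPolygon k τ) {p q : ℂ}
    (h : IsPolygonChord τ p q) : segment ℝ p q ⊆ polygonRegion τ :=
  let ⟨i, j, _, h1, _⟩ := h
  segment_subset_polygonRegion (hτ.side_subset i h1.1) (hτ.side_subset j h1.2)

/-- The line of a chord meets the polygon in the chord only. -/
lemma IsPolygonChord.mem_segment (hτ : IsConvexPolygon k τ) {p q x : ℂ}
    (h : IsPolygonChord τ p q) (hpq : p ≠ q) (hx : x ∈ polygonRegion τ)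
    (h0 : planeOrient p q x = 0) : x ∈ segment ℝ p q := by
  obtain ⟨s, rfl⟩ := exists_combo_of_orient_eq_zero hpq h0
  obtain ⟨i, j, hij, ⟨hp, hq⟩, hp', hq'⟩ := h
  have h1 := hx i
  have h2 := hx j
  rw [planeOrient_combo _ _ _ _ _ _ (by ring), orient_eq_zero_of_mem_side hp] at h1
  rw [planeOrient_combo _ _ _ _ _ _ (by ring), orient_eq_zero_of_mem_side hq] at h2
  have h3 := hτ.orient_pos_of_mem_side hij hp hp'
  have h4 := hτ.orient_pos_of_mem_side hij.symm hq hq'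
  refine ⟨1 - s, s, ?_, ?_, by ring, rfl⟩
  · by_contra hs
    nlinarith [mul_neg_of_neg_of_pos (not_le.1 hs) h3]
  · by_contra hs
    nlinarith [mul_neg_of_neg_of_pos (not_le.1 hs) h4]

/-- There are corners strictly on the right of the line of a chord. -/
lemma IsPolygonChord.exists_corner_neg (hτ : IsConvexPolygon k τ) {p q : ℂ}
    (h : IsPolygonChord τ p q) (hpq : p ≠ q) : ∃ c : Fin k, planeOrient p q (τ c) < 0 := by
  by_contra! hn
  obtain ⟨i, j, hij, ⟨hp, hq⟩, hp', hq'⟩ := h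
  have key : ∀ (i : Fin k) (x : ℂ), x ∈ polygonSide τ i → x ∉ Set.range τ →
      planeOrient p q x = 0 →
      planeOrient p q (τ i) = 0 ∧ planeOrient p q (τ (finRotate k i)) = 0 := by
    intro i x hx hx' h0
    obtain ⟨s, t, hs, ht, hst, rfl⟩ := exists_combo_of_mem_side hx hx'
    rw [planeOrient_combo _ _ _ _ _ _ hst] at h0
    have h1 := mul_nonneg hs.le (hn i)
    have h2 := mul_nonneg ht.le (hn (finRotate k i))
    constructor
    · exact (mul_eq_zero.1 (show s * planeOrient p q (τ i) = 0 by linarith)).resolve_left hs.ne'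
    · exact (mul_eq_zero.1 (show t * planeOrient p q (τ (finRotate k i)) = 0 by
        linarith)).resolve_left ht.ne'
  obtain ⟨a1, a2⟩ := key i p hp hp' (planeOrient_left p q)
  obtain ⟨b1, b2⟩ := key j q hq hq' (planeOrient_right p q)
  -- three corners on one line
  have hcol : ∀ c, planeOrient p q (τ c) = 0 →
      planeOrient (τ j) (τ (finRotate k j)) (τ c) = 0 := by
    intro c hc
    obtain ⟨s, hs⟩ := exists_combo_of_orient_eq_zero hpq b1
    obtain ⟨t, ht⟩ := exists_combo_of_orient_eq_zero hpq b2
    obtain ⟨u, hu⟩ := exists_combo_of_orient_eq_zero hpq hc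
    rw [hs, ht, hu]
    simp [planeOrient]; ring
  rcases hτ.exists_end hij with h | h
  · exact (hτ.left_of_side j _ h.1 h.2).ne' (hcol _ a1)
  · exact (hτ.left_of_side j _ h.1 h.2).ne' (hcol _ a2)

/-- Two points of the polygon that are not separated by a chord lie strictly on the same side. -/
lemma IsPolygonChord.same_side (hτ : IsConvexPolygon k τ) {p q x y : ℂ}
    (h : IsPolygonChord τ p q) (hpq : p ≠ q) (hx : x ∈ polygonRegion τ)
    (hy : y ∈ polygonRegion τ) (hd : ¬ (segment ℝ p q ∩ segment ℝ x y).Nonempty) :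
    0 < planeOrient p q x * planeOrient p q y := by
  by_contra hn
  have hz : ∀ z ∈ segment ℝ x y, planeOrient p q z ≠ 0 := fun z hz h0 =>
    hd ⟨z, h.mem_segment hτ hpq (segment_subset_polygonRegion hx hy hz) h0, hz⟩
  have hx0 := hz x (left_mem_segment ℝ x y)
  have hy0 := hz y (right_mem_segment ℝ x y)
  have hxy : planeOrient p q x * planeOrient p q y < 0 :=
    lt_of_le_of_ne (not_lt.1 hn) (mul_ne_zero hx0 hy0)
  rcases mul_neg_iff.1 hxy with ⟨h1, h2⟩ | ⟨h1, h2⟩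
  · have h3 : 0 < planeOrient p q x - planeOrient p q y := by linarith
    refine hz _ ⟨-planeOrient p q y / (planeOrient p q x - planeOrient p q y),
      planeOrient p q x / (planeOrient p q x - planeOrient p q y), div_nonneg (by linarith) h3.le,
      div_nonneg h1.le h3.le, by field_simp; ring, rfl⟩ ?_
    rw [planeOrient_combo _ _ _ _ _ _ (by field_simp; ring)]
    field_simp
    ring
  · have h3 : 0 < planeOrient p q y - planeOrient p q x := by linarith
    refine hz _ ⟨planeOrient p q y / (planeOrient p q y - planeOrient p q x),
      -planeOrient p q x / (planeOrient p q y - planeOrient p q x), div_nonneg h2.le h3.le,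
      div_nonneg (by linarith) h3.le, by field_simp; ring, rfl⟩ ?_
    rw [planeOrient_combo _ _ _ _ _ _ (by field_simp; ring)]
    field_simp
    ring

end Polygon

/-- In a polygon representation of a cycle, each chord has a side without the chords of the
non-neighbours. This side has a corner, and no corner is on that side of two chords that do not
meet. -/
theorem le_of_hasPolygonRepresentation_cycleGraph {n k : ℕ} (hn : 5 ≤ n)
    (h : HasPolygonRepresentation k (SimpleGraph.cycleGraph n)) : n ≤ 2 * k := by
  obtain ⟨τ, hτ, a, b, hside, hcor, hm⟩ := h
  have hch : ∀ v, IsPolygonChord τ (a v) (b v) := fun v =>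
    let ⟨i, j, hij, h⟩ := hside v
    ⟨i, j, hij, h, hcor v⟩
  have hab : ∀ v, a v ≠ b v := fun v e => by
    simpa using @hm.endpoints_distinct (.inl v) (.inr v) e
  have hmem : ∀ v x, x ∈ segment ℝ (a v) (b v) → x ∈ polygonRegion τ := fun v _ hx =>
    (hch v).segment_subset hτ hx
  -- the points of a chord disjoint from that of `v` are on the same side
  have hsame : ∀ v j, j ≠ v → ¬ (SimpleGraph.cycleGraph n).Adj v j →
      ∀ x ∈ segment ℝ (a j) (b j), ∀ y ∈ segment ℝ (a j) (b j),
      0 < planeOrient (a v) (b v) x * planeOrient (a v) (b v) y := by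
    intro v j hjv hadj x hx y hy
    refine (hch v).same_side hτ (hab v) (hmem j x hx) (hmem j y hy) ?_
    rw [hm.adj_iff v j hjv.symm] at hadj
    rintro ⟨z, hz1, hz2⟩
    exact hadj ⟨z, hz1, (convex_segment (a j) (b j)).segment_subset hx hy hz2⟩
  -- the side of the chord of `v` on which the other chords are, as a sign
  have hsign : ∀ v, ∃ ε : ℝ, (ε = 1 ∨ ε = -1) ∧
      ∀ j, j ≠ v → ¬ (SimpleGraph.cycleGraph n).Adj v j → ∀ x ∈ segment ℝ (a j) (b j),
        0 < ε * planeOrient (a v) (b v) x := by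
    intro v
    by_cases hpos : ∀ j, j ≠ v → ¬ (SimpleGraph.cycleGraph n).Adj v j →
        ∀ x ∈ segment ℝ (a j) (b j), 0 < planeOrient (a v) (b v) x
    · exact ⟨1, .inl rfl, by simpa using hpos⟩
    · push Not at hpos
      obtain ⟨j, hj, hadj, x, hx, hle⟩ := hpos
      refine ⟨-1, .inr rfl, fun j' hj' hadj' => ?_⟩
      refine cycleGraph_nonneighbors_connected (by omega) v
        (fun j => ∀ x ∈ segment ℝ (a j) (b j), 0 < -1 * planeOrient (a v) (b v) x)
        ?_ hj hj' hadj hadj' ?_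
      · intro j j' hjj' hj hj' hadj hadj' hneg y hy
        obtain ⟨z, hz, hz'⟩ := (hm.adj_iff j j' hjj'.ne).1 hjj'
        have h1 := hneg z hz
        have h2 := hsame v j' hj' hadj' z hz' y hy
        nlinarith [neg_of_mul_pos_right h2 (by linarith)]
      · intro y hy
        have h2 := hsame v j hj hadj x hx y hy
        have := neg_of_mul_pos_right h2 hle
        linarith
  choose ε hε hsign using hsign
  have hcorner : ∀ v, ∃ c : Fin k, ε v * planeOrient (a v) (b v) (τ c) < 0 := by
    intro v
    rcases hε v with h | h
    · obtain ⟨c, hc⟩ := (hch v).exists_corner_neg hτ (hab v)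
      exact ⟨c, by rw [h]; linarith⟩
    · obtain ⟨c, hc⟩ := (hch v).symm.exists_corner_neg hτ (hab v).symm
      refine ⟨c, ?_⟩
      rw [h, planeOrient_swap, planeOrient_rotate, planeOrient_rotate]
      linarith
  choose c hc using hcorner
  have hadj : ∀ u v, u ≠ v → c u = c v → (SimpleGraph.cycleGraph n).Adj u v := by
    intro u v huv hcuv
    by_contra hadj
    -- walk from the corner to the chord of `v`; this crosses the line of `u` in its chord
    have hx := hτ.corner_mem (c u)
    have hy := hmem v _ (left_mem_segment ℝ (a v) (b v))
    have h1 := hc u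
    have h2 := hsign u v huv.symm hadj (a v) (left_mem_segment ℝ _ _)
    by_cases hd : (segment ℝ (a u) (b u) ∩ segment ℝ (τ (c u)) (a v)).Nonempty
    · obtain ⟨z, hz, s, t, hs, ht, hst, rfl⟩ := hd
      have h3 := hsign v u huv (fun h => hadj h.symm) _ hz
      have h4 := hc v
      rw [planeOrient_combo _ _ _ _ _ _ hst, planeOrient_left, hcuv] at h3
      nlinarith
    · have h3 := (hch u).same_side hτ (hab u) hx hy hd
      nlinarith [mul_neg_of_neg_of_pos h1 h2, mul_self_nonneg (ε u)]
  have hcard := Finset.card_le_mul_card_image_of_maps_to (s := (Finset.univ : Finset (Fin n)))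
    (t := (Finset.univ : Finset (Fin k))) (f := c) (fun _ _ => Finset.mem_univ _) 2 (by
      intro e _
      by_contra hlt
      obtain ⟨u, hu, v, hv, w, hw, huv, huw, hvw⟩ := Finset.two_lt_card.1 (not_le.1 hlt)
      simp only [Finset.mem_filter, Finset.mem_univ, true_and] at hu hv hw
      have h1 := hadj u v huv (hu.trans hv.symm)
      have h2 := hadj u w huw (hu.trans hw.symm)
      have h3 := hadj v w hvw (hv.trans hw.symm)
      rw [cycleGraph_adj_iff (by omega)] at h1 h2 h3
      have := Fin.val_ne_of_ne huv
      have := Fin.val_ne_of_ne huw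
      have := Fin.val_ne_of_ne hvw
      omega)
  simpa using hcard

theorem le_polygonNumber_cycleGraph (n : ℕ) :
    (((n + 1) / 2 : ℕ) : ℕ∞) ≤ polygonNumber (SimpleGraph.cycleGraph n) := by
  refine le_iInf₂ fun k hk => ?_
  norm_cast
  rcases lt_or_ge n 5 with hn | hn
  · rcases hk with ⟨h, -⟩ | ⟨h, -⟩ <;> omega
  · rcases hk with ⟨-, h⟩ | ⟨-, h⟩
    · exact (not_isPermutationGraph_cycleGraph hn h).elim
    · have := le_of_hasPolygonRepresentation_cycleGraph hn h
      omega

theorem theorem2p5 :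
    (∀ {V : Type*} [Fintype V] (G : SimpleGraph V), IsCircleGraph G → 3 ≤ Fintype.card V →
      polygonNumber G ≤ ((⌈(Fintype.card V : ℚ) / 2⌉₊ : ℕ) : ℕ∞)) ∧
    (∀ n : ℕ, 3 ≤ n → IsCircleGraph (SimpleGraph.cycleGraph n) ∧
      polygonNumber (SimpleGraph.cycleGraph n) = ((⌈(n : ℚ) / 2⌉₊ : ℕ) : ℕ∞)) := by
  refine ⟨fun G hG hV => ?_, fun n hn => ?_⟩
  · rw [ceil_half]
    exact hG.polygonNumber_le hV
  · have hc := isCircleGraph_cycleGraph hn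
    rw [ceil_half]
    refine ⟨hc, le_antisymm ?_ (le_polygonNumber_cycleGraph n)⟩
    simpa using hc.polygonNumber_le (by simpa using hn)
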